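/- Let $G$ be a connected (real, finite-dimensional, $C^\infty$) Lie group of dimension $n$ with identity $e$ and Lie algebra $\mathfrak g=T_eG$, and let $\Pi$ be a Poisson–Lie structure on $G$: a smooth bivector field whose bracket $\{F,K\}=\Pi(\mathrm dF,\mathrm dK)$ on $C^\infty(G)$ satisfies the Jacobi identity and which is multiplicative, $\Pi(gh)=(L_g)_*\Pi(h)+(R_h)_*\Pi(g)$ for all $g,h\in G$. Let $\delta=\mathrm d_e\Pi:\mathfrak g\to\wedge^2\mathfrak g$ be the differential of $\Pi$ at $e$ (well defined since $\Pi(e)=0$), and equip $\mathfrak g^*$ with the dual Lie bracket $\langle[\alpha,\beta]_{\mathfrak g^*},\xi\rangle=\delta(\xi)(\alpha,\beta)$. Assume that $\mathfrak g^*$ is unimodular, i.e. $\operatorname{Tr}([\alpha,\cdot\,]_{\mathfrak g^*})=0$ for every $\alpha\in\mathfrak g^*$. Let $f_0:G\to\mathbb R$, $f_0(g)=\det(\mathrm{Ad}^n_g)$, where $\mathrm{Ad}^n_g:\wedge^n\mathfrak g\to\wedge^n\mathfrak g$ is induced by the adjoint action $\mathrm{Ad}_g$. Then for every $\nu\in\wedge^n\mathfrak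 g^*$ with $\nu\neq0$, with $\nu^l$ the left-invariant $n$-form on $G$ whose value at $e$ is $\nu$, the $n$-form $\sqrt{f_0}\,\nu^l$ is a (smooth, nowhere vanishing) volume form on $G$ and is preserved by all Hamiltonian vector fields: for every $K\in C^\infty(G)$, $$\mathcal L_{X^\Pi_K}\big(\sqrt{f_0}\,\nu^l\big)=0,$$ where $X^\Pi_K=\Pi^\sharp(\mathrm dK)$ and $\langle\Pi^\sharp(\alpha),\beta\rangle=\Pi(\alpha,\beta)$. -/

import Mathlib

open scoped Manifold ContDiff Topology
open Module VectorField

noncomputable section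

namespace PoissonLie

/-! ### Tensor fields on a manifold -/

section Manifold

variable {E : Type*} [NormedAddCommGroup E] [NormedSpace ℝ E]
  {H : Type*} [TopologicalSpace H] (I : ModelWithCorners ℝ E H)
  {M : Type*} [TopologicalSpace M] [ChartedSpace H M]

instance instFiniteDimensionalTangentSpace [FiniteDimensional ℝ E] (x : M) :
    FiniteDimensional ℝ (TangentSpace I x) :=
  inferInstanceAs (FiniteDimensional ℝ E)

/-- The cotangent space `T*ₓM`. -/
abbrev CotangentSpace (x : M) : Type _ := Dual ℝ (TangentSpace I x)

/-- The differential `dF(x) ∈ T*ₓM` of a real function. -/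
def differential (F : M → ℝ) (x : M) : CotangentSpace I x :=
  (mvfderiv I F x : TangentSpace I x →ₗ[ℝ] ℝ)

theorem differential_add {F K : M → ℝ} {x : M} (hF : MDifferentiableAt I 𝓘(ℝ, ℝ) F x)
    (hK : MDifferentiableAt I 𝓘(ℝ, ℝ) K x) :
    differential I (fun y => F y + K y) x = differential I F x + differential I K x := by
  ext v
  simp [differential, mvfderiv_fun_add hF hK]

theorem differential_const_mul {F : M → ℝ} {x : M} (c : ℝ)
    (hF : MDifferentiableAt I 𝓘(ℝ, ℝ) F x) :
    differential I (fun y => c * F y) x = c • differential I F x := by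
  ext v
  simp [differential, mvfderiv_fun_mul (mdifferentiableAt_const (c := c)) hF, mvfderiv_const]

/-- Smooth (`C^∞`) vector fields. -/
def IsSmoothVectorField [IsManifold I ∞ M] (X : ∀ x : M, TangentSpace I x) : Prop :=
  ContMDiff I I.tangent ∞ (fun x => (⟨x, X x⟩ : TangentBundle I M))

/-- Smooth `1`-forms: those taking smooth values on smooth vector fields. -/
def IsSmoothOneForm [IsManifold I ∞ M] (α : ∀ x : M, CotangentSpace I x) : Prop :=
  ∀ X : ∀ x : M, TangentSpace I x, IsSmoothVectorField I X →
    ContMDiff I 𝓘(ℝ, ℝ) ∞ (fun x => α x (X x))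

/-- Smooth differential `k`-forms: those taking smooth values on smooth vector fields. -/
def IsSmoothForm [IsManifold I ∞ M] {k : ℕ}
    (Φ : ∀ x : M, (TangentSpace I x) [⋀^Fin k]→ₗ[ℝ] ℝ) : Prop :=
  ∀ Y : Fin k → ∀ x : M, TangentSpace I x, (∀ i, IsSmoothVectorField I (Y i)) →
    ContMDiff I 𝓘(ℝ, ℝ) ∞ (fun x => Φ x (fun i => Y i x))

/-- A volume form: a smooth form of top degree that vanishes nowhere. -/
structure IsVolumeForm [IsManifold I ∞ M] {n : ℕ}
    (Φ : ∀ x : M, (TangentSpace I x) [⋀^Fin n]→ₗ[ℝ] ℝ) : Prop where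
  top_degree : finrank ℝ E = n
  smooth : IsSmoothForm I Φ
  ne_zero : ∀ x, Φ x ≠ 0

/-- The Lie derivative `ℒ_X Φ` of a `k`-form, evaluated at `x` on vector fields `Y₁, …, Yₖ`:
`X(Φ(Y₁, …, Yₖ)) - ∑ᵢ Φ(Y₁, …, [X, Yᵢ], …, Yₖ)`. -/
def lieDerivative {k : ℕ} (X : ∀ x : M, TangentSpace I x)
    (Φ : ∀ x : M, (TangentSpace I x) [⋀^Fin k]→ₗ[ℝ] ℝ)
    (Y : Fin k → ∀ x : M, TangentSpace I x) (x : M) : ℝ :=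
  differential I (fun y => Φ y (fun i => Y i y)) x (X x)
    - ∑ i, Φ x (Function.update (fun j => Y j x) i (mlieBracket I X (Y i) x))

/-- The form `Φ` is preserved by the vector field `X`: `ℒ_X Φ = 0`. -/
def Preserves [IsManifold I ∞ M] {k : ℕ} (X : ∀ x : M, TangentSpace I x)
    (Φ : ∀ x : M, (TangentSpace I x) [⋀^Fin k]→ₗ[ℝ] ℝ) : Prop :=
  ∀ Y : Fin k → ∀ x : M, TangentSpace I x, (∀ i, IsSmoothVectorField I (Y i)) →
    ∀ x, lieDerivative I X Φ Y x = 0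

/-- A `2`-vector field is a family of alternating bilinear forms on the cotangent spaces.
`bracket I B F K` is the function `{F, K} = B(dF, dK)`. -/
def bracket (B : ∀ x : M, LinearMap.BilinForm ℝ (CotangentSpace I x)) (F K : M → ℝ) (x : M) : ℝ :=
  B x (differential I F x) (differential I K x)

variable (M) in
/-- A Poisson structure: a smooth `2`-vector field whose bracket of functions satisfies the
Jacobi identity. -/
structure PoissonStructure [IsManifold I ∞ M] where
  /-- the value of the `2`-vector field at a point, as a bilinear form on the cotangent space -/
  toBilin : ∀ x : M, LinearMap.BilinForm ℝ (CotangentSpace I x)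
  alt : ∀ x, (toBilin x).IsAlt
  smooth : ∀ α β : ∀ x : M, CotangentSpace I x, IsSmoothOneForm I α → IsSmoothOneForm I β →
    ContMDiff I 𝓘(ℝ, ℝ) ∞ (fun x => toBilin x (α x) (β x))
  jacobi : ∀ F K L : M → ℝ, ContMDiff I 𝓘(ℝ, ℝ) ∞ F → ContMDiff I 𝓘(ℝ, ℝ) ∞ K →
    ContMDiff I 𝓘(ℝ, ℝ) ∞ L → ∀ x,
      bracket I toBilin F (bracket I toBilin K L) x
        + bracket I toBilin K (bracket I toBilin L F) x
        + bracket I toBilin L (bracket I toBilin F K) x = 0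

variable {I}

/-- `Π^♯ : T*ₓM → TₓM`, determined by `⟨Π^♯(α), β⟩ = Π(x)(α, β)`. -/
def PoissonStructure.sharp [FiniteDimensional ℝ E] [IsManifold I ∞ M] (P : PoissonStructure I M)
    (x : M) : CotangentSpace I x →ₗ[ℝ] TangentSpace I x :=
  (evalEquiv ℝ (TangentSpace I x)).symm.toLinearMap ∘ₗ P.toBilin x

theorem PoissonStructure.apply_sharp [FiniteDimensional ℝ E] [IsManifold I ∞ M]
    (P : PoissonStructure I M) (x : M) (α β : CotangentSpace I x) :
    β (P.sharp x α) = P.toBilin x α β := by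
  simp [PoissonStructure.sharp]

/-- The Hamiltonian vector field `X_K = Π^♯(dK)`. -/
def PoissonStructure.hamiltonianVectorField [FiniteDimensional ℝ E] [IsManifold I ∞ M]
    (P : PoissonStructure I M) (K : M → ℝ) (x : M) : TangentSpace I x :=
  P.sharp x (differential I K x)

end Manifold

/-! ### Poisson-Lie groups -/

section LieGroup

variable {E : Type*} [NormedAddCommGroup E] [NormedSpace ℝ E]
  {H : Type*} [TopologicalSpace H] (I : ModelWithCorners ℝ E H)
  {G : Type*} [TopologicalSpace G] [ChartedSpace H G] [Group G]

/-- The differential at `g` of the left translation by `g⁻¹`, as a map `T_gG → 𝔤 = T_eG`. -/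
def leftTrivialization (g : G) : TangentSpace I g →L[ℝ] GroupLieAlgebra I G :=
  mfderiv I I (fun x : G => g⁻¹ * x) g

/-- The left-invariant `1`-form `αˡ` with value `α ∈ 𝔤*` at the identity. -/
def leftInvariantOneForm (α : Dual ℝ (GroupLieAlgebra I G)) (g : G) : CotangentSpace I g :=
  α ∘ₗ (leftTrivialization I g).toLinearMap

/-- The left-invariant `k`-form `νˡ` with value `ν ∈ ⋀ᵏ𝔤*` at the identity. -/
def leftInvariantForm {k : ℕ} (ν : (GroupLieAlgebra I G) [⋀^Fin k]→ₗ[ℝ] ℝ) (g : G) :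
    (TangentSpace I g) [⋀^Fin k]→ₗ[ℝ] ℝ :=
  ν.compLinearMap (leftTrivialization I g).toLinearMap

/-- The adjoint representation: `Ad_g : 𝔤 → 𝔤` is the differential at the identity of
`x ↦ g x g⁻¹`. -/
def Ad (g : G) : GroupLieAlgebra I G →L[ℝ] GroupLieAlgebra I G :=
  mfderiv I I (fun x : G => g * x * g⁻¹) 1

/-- `f₀(g) = det(Adⁿ_g)`, where `Adⁿ_g : ⋀ⁿ𝔤 → ⋀ⁿ𝔤` is induced by `Ad_g`. -/
def f₀ (n : ℕ) (g : G) : ℝ :=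
  LinearMap.det (exteriorPower.map n (Ad I g).toLinearMap)

variable {I}

/-- Multiplicativity: `Π(gh) = (L_g)_* Π(h) + (R_h)_* Π(g)`. -/
def PoissonStructure.IsMultiplicative [IsManifold I ∞ G] (P : PoissonStructure I G) : Prop :=
  ∀ (g h : G) (α β : CotangentSpace I (g * h)),
    P.toBilin (g * h) α β =
      P.toBilin h (α ∘ₗ (mfderiv I I (fun x : G => g * x) h).toLinearMap)
          (β ∘ₗ (mfderiv I I (fun x : G => g * x) h).toLinearMap)
        + P.toBilin g (α ∘ₗ (mfderiv I I (fun x : G => x * h) g).toLinearMap)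
          (β ∘ₗ (mfderiv I I (fun x : G => x * h) g).toLinearMap)

/-- Left-invariant `1`-forms are smooth. -/
theorem isSmoothOneForm_leftInvariantOneForm [FiniteDimensional ℝ E] [LieGroup I ∞ G]
    (α : Dual ℝ (GroupLieAlgebra I G)) : IsSmoothOneForm I (leftInvariantOneForm I α) := by
  intro Y hY
  let zero : G → TangentBundle I G := fun g => Bundle.zeroSection E (TangentSpace I) g⁻¹
  have h0 : ContMDiff I I.tangent ∞ zero :=
    (Bundle.contMDiff_zeroSection ℝ (TangentSpace I)).comp (contMDiff_inv I ∞)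
  have hp : ContMDiff I (I.tangent.prod I.tangent) ∞
      (fun g => (zero g, (⟨g, Y g⟩ : TangentBundle I G))) := h0.prodMk hY
  have hm : ContMDiff (I.prod I).tangent I.tangent ∞
      (tangentMap (I.prod I) I (fun p : G × G => p.1 * p.2)) :=
    (contMDiff_mul I ∞).contMDiff_tangentMap (by simp)
  have hS := hm.comp ((contMDiff_equivTangentBundleProd_symm (n := ∞)).comp hp)
  have hw : ∀ g : G, (tangentMap (I.prod I) I (fun p : G × G => p.1 * p.2)
      ((equivTangentBundleProd I G I G).symm (zero g, ⟨g, Y g⟩))) =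
        (⟨1, leftTrivialization I g (Y g)⟩ : TangentBundle I G) := by
    intro g
    have hd := mfderiv_prod_eq_add_apply (I := I) (I' := I) (I'' := I)
      (f := fun p : G × G => p.1 * p.2) (p := (g⁻¹, g)) (v := ((0 : E), (Y g : E)))
      ((contMDiff_mul I ∞).mdifferentiableAt (by simp))
    have hd' : (mfderiv (I.prod I) I (fun p : G × G => p.1 * p.2) (g⁻¹, g) ((0 : E), (Y g : E)) : E)
        = leftTrivialization I g (Y g) := by
      refine Eq.trans hd ?_
      have : mfderiv I I (fun z : G => z * g) g⁻¹ (0 : TangentSpace I g⁻¹) = 0 := map_zero _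
      exact (congrArg (· + (leftTrivialization I g (Y g) : E)) this).trans (zero_add _)
    have key : ∀ (a b : G) (u v : E), a = b → u = v →
        (⟨a, u⟩ : TangentBundle I G) = ⟨b, v⟩ := by
      rintro a _ u _ rfl rfl; rfl
    exact key _ _ _ _ (inv_mul_cancel g) hd'
  have hS' : ContMDiff I I.tangent ∞
      (fun g : G => (⟨1, leftTrivialization I g (Y g)⟩ : TangentBundle I G)) := by
    convert hS using 1
    funext g
    exact (hw g).symm
  let w : G → E := fun g => leftTrivialization I g (Y g)
  have hE : ContMDiff I 𝓘(ℝ, E) ∞ w := by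
    intro g
    have := (Bundle.contMDiffAt_totalSpace.1 (hS' g)).2
    refine this.congr_of_eventuallyEq (Filter.Eventually.of_forall fun x => ?_)
    have hc := tangentCoordChange_self (I := I) (x := (1 : G)) (z := 1)
      (v := (leftTrivialization I x (Y x) : E)) (mem_extChartAt_source (1 : G))
    exact hc.symm
  let αc : E →L[ℝ] ℝ := LinearMap.toContinuousLinearMap (show E →ₗ[ℝ] ℝ from α)
  exact αc.contMDiff.comp hE

/-- The left trivialization of a Poisson structure, evaluated on two covectors, is smooth. -/
theorem PoissonStructure.contMDiff_left [FiniteDimensional ℝ E] [LieGroup I ∞ G]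
    (P : PoissonStructure I G) (α β : Dual ℝ (GroupLieAlgebra I G)) :
    ContMDiff I 𝓘(ℝ, ℝ) ∞ (fun g : G =>
      P.toBilin g (leftInvariantOneForm I α g) (leftInvariantOneForm I β g)) :=
  P.smooth _ _ (isSmoothOneForm_leftInvariantOneForm α) (isSmoothOneForm_leftInvariantOneForm β)

/-- The differential `δ = d_eΠ : 𝔤 → ⋀²𝔤` of a Poisson-Lie structure at the identity, with
elements of `⋀²𝔤` viewed as bilinear forms on `𝔤*`. As `Π(e) = 0`, it is the derivative at `e` of
`Π` read in any trivialization of the tangent bundle; the left one is used. -/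
def PoissonStructure.cobracket [FiniteDimensional ℝ E] [LieGroup I ∞ G]
    (P : PoissonStructure I G) :
    GroupLieAlgebra I G →ₗ[ℝ] LinearMap.BilinForm ℝ (Dual ℝ (GroupLieAlgebra I G)) :=
  have hd (α β : Dual ℝ (GroupLieAlgebra I G)) : MDifferentiableAt I 𝓘(ℝ, ℝ) (fun g : G =>
      P.toBilin g (leftInvariantOneForm I α g) (leftInvariantOneForm I β g)) 1 :=
    (P.contMDiff_left α β).mdifferentiableAt (by simp)
  { toFun := fun ξ => LinearMap.mk₂ ℝ (fun α β => differential I (fun g : G =>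
        P.toBilin g (leftInvariantOneForm I α g) (leftInvariantOneForm I β g)) 1 ξ)
      (fun α α' β => by
        simpa [leftInvariantOneForm, LinearMap.add_comp] using
          LinearMap.congr_fun (differential_add I (hd α β) (hd α' β)) ξ)
      (fun c α β => by
        simpa [leftInvariantOneForm, LinearMap.smul_comp] using
          LinearMap.congr_fun (differential_const_mul I c (hd α β)) ξ)
      (fun α β β' => by
        simpa [leftInvariantOneForm, LinearMap.add_comp] using
          LinearMap.congr_fun (differential_add I (hd α β) (hd α β')) ξ)
      (fun c α β => by
        simpa [leftInvariantOneForm, LinearMap.smul_comp] using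
          LinearMap.congr_fun (differential_const_mul I c (hd α β)) ξ)
    map_add' := fun ξ η => by ext α β; simp
    map_smul' := fun c ξ => by ext α β; simp }

/-- The bracket `[α, β] = δ*(α ∧ β)` on `𝔤*`, in the form of `ad_α = [α, ·]`:
`⟨[α, β], ξ⟩ = δ(ξ)(α, β)`. -/
def PoissonStructure.adDual [FiniteDimensional ℝ E] [LieGroup I ∞ G]
    (P : PoissonStructure I G) (α : Dual ℝ (GroupLieAlgebra I G)) :
    Dual ℝ (GroupLieAlgebra I G) →ₗ[ℝ] Dual ℝ (GroupLieAlgebra I G) :=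
  (P.cobracket.flip α).flip

theorem PoissonStructure.adDual_apply [FiniteDimensional ℝ E] [LieGroup I ∞ G]
    (P : PoissonStructure I G) (α β : Dual ℝ (GroupLieAlgebra I G)) (ξ : GroupLieAlgebra I G) :
    P.adDual α β ξ = P.cobracket ξ α β := rfl

/-- The dual Lie algebra `𝔤*` is unimodular: its modular character `α ↦ Tr(ad_α)` vanishes. -/
def PoissonStructure.IsUnimodularDual [FiniteDimensional ℝ E] [LieGroup I ∞ G]
    (P : PoissonStructure I G) : Prop :=
  ∀ α : Dual ℝ (GroupLieAlgebra I G), LinearMap.trace ℝ _ (P.adDual α) = 0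

end LieGroup

end PoissonLie

end

noncomputable section

namespace PoissonLie

/-! ### Linear algebra -/

section LinearAlgebra

variable {V : Type*} [AddCommGroup V] [Module ℝ V] [FiniteDimensional ℝ V] {n : ℕ}

theorem alternatingMap_apply_comp (hn : finrank ℝ V = n) (ν : V [⋀^Fin n]→ₗ[ℝ] ℝ)
    (A : V →ₗ[ℝ] V) (v : Fin n → V) : ν (fun i => A (v i)) = LinearMap.det A * ν v := by
  let b : Basis (Fin n) ℝ V := finBasisOfFinrankEq ℝ V hn
  have h := ν.eq_smul_basis_det b
  rw [h]
  have := Basis.det_comp b A v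
  simp only [AlternatingMap.smul_apply, smul_eq_mul]
  rw [show (fun i => A (v i)) = A ∘ v from rfl, this]
  ring

/-- A top degree form transforms under a derivation by the trace. -/
theorem sum_alternatingMap_update (hn : finrank ℝ V = n) (ν : V [⋀^Fin n]→ₗ[ℝ] ℝ)
    (A : V →ₗ[ℝ] V) (v : Fin n → V) :
    ∑ i, ν (Function.update v i (A (v i))) = LinearMap.trace ℝ V A * ν v := by
  classical
  let b : Basis (Fin n) ℝ V := finBasisOfFinrankEq ℝ V hn
  let L : MultilinearMap ℝ (fun _ : Fin n => V) ℝ :=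
    ∑ i, ν.toMultilinearMap.compLinearMap (fun j => if j = i then A else LinearMap.id)
  have hL : ∀ w : Fin n → V, L w = ∑ i, ν (Function.update w i (A (w i))) := by
    intro w
    simp only [L, sum_apply, MultilinearMap.compLinearMap_apply]
    refine Finset.sum_congr rfl fun i _ => ?_
    simp only [AlternatingMap.coe_multilinearMap]
    congr 1
    funext j
    by_cases h : j = i
    · subst h; simp
    · simp [h]
  have key : L = LinearMap.trace ℝ V A • ν.toMultilinearMap := by
    refine Basis.ext_multilinear (fun _ => b) fun s => ?_
    rw [hL]
    simp only [smul_apply, AlternatingMap.coe_multilinearMap, smul_eq_mul]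
    by_cases hs : Function.Injective s
    · let e : Fin n ≃ Fin n := Equiv.ofBijective s (Finite.injective_iff_bijective.1 hs)
      let b' := b.reindex e.symm
      have hb' : (fun i => b (s i)) = b' := by
        funext i; simp [b', e]
      simp only [show ∀ i, b (s i) = b' i from fun i => congrFun hb' i]
      rw [LinearMap.trace_eq_matrix_trace ℝ b', Matrix.trace, Finset.sum_mul]
      refine Finset.sum_congr rfl fun i _ => ?_
      conv_lhs => rw [← b'.sum_repr (A (b' i))]
      have : ν (Function.update (⇑b') i (∑ k, b'.repr (A (b' i)) k • b' k))
          = ∑ k, b'.repr (A (b' i)) k * ν (Function.update (⇑b') i (b' k)) := by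
        rw [AlternatingMap.map_update_sum]
        simp only [AlternatingMap.map_update_smul, smul_eq_mul]
      rw [this, Finset.sum_eq_single i]
      · simp [LinearMap.toMatrix_apply]
      · intro k _ hk
        rw [AlternatingMap.map_update_self _ _ hk.symm, mul_zero]
      · simp
    · simp only [Function.Injective, not_forall] at hs
      obtain ⟨p, q, hpq, hne⟩ := hs
      rw [ν.map_eq_zero_of_eq (fun i => b (s i)) (by simp [hpq] : b (s p) = b (s q)) hne, mul_zero]
      rw [← Finset.add_sum_erase _ _ (Finset.mem_univ p),
        ← Finset.add_sum_erase _ _ (Finset.mem_erase.2 ⟨Ne.symm hne, Finset.mem_univ q⟩),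
        Finset.sum_eq_zero, add_zero]
      · have hsw := ν.map_swap (Function.update (fun i => b (s i)) q (A (b (s q)))) hne
        have : (Function.update (fun i => b (s i)) q (A (b (s q)))) ∘ Equiv.swap p q
            = Function.update (fun i => b (s i)) p (A (b (s p))) := by
          funext j
          by_cases hjp : j = p
          · subst hjp; simp [hpq]
          · by_cases hjq : j = q
            · subst hjq
              simp [hne, Function.update_of_ne hjp, hpq]
            · simp [Equiv.swap_apply_of_ne_of_ne hjp hjq, hjp, hjq]
        rw [this] at hsw
        rw [hsw]; ring
      · intro i hi
        simp only [Finset.mem_erase] at hi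
        refine ν.map_eq_zero_of_eq _ ?_ hne
        rw [Function.update_of_ne hi.2.1.symm, Function.update_of_ne hi.1.symm, hpq]
  have := congrArg (fun f => f v) key
  rw [← hL]
  simpa using this

/-- On the top exterior power, a linear map acts with determinant its own determinant. -/
theorem det_exteriorPower_map (hn : finrank ℝ V = n) (A : V →ₗ[ℝ] V) :
    LinearMap.det (exteriorPower.map n A) = LinearMap.det A := by
  have h : exteriorPower.map n A = LinearMap.det A • LinearMap.id := by
    apply exteriorPower.linearMap_ext
    ext v : 1
    rw [← sub_eq_zero, ← Module.forall_dual_apply_eq_zero_iff ℝ]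
    intro φ
    have := alternatingMap_apply_comp hn (φ.compAlternatingMap (exteriorPower.ιMulti ℝ n)) A v
    simp only [LinearMap.compAlternatingMap_apply] at this
    rw [map_sub, sub_eq_zero]
    simpa [exteriorPower.map_apply_ιMulti, Function.comp_def] using this
  rw [h, LinearMap.det_smul, LinearMap.det_id, exteriorPower.finrank_eq, hn]
  simp

end LinearAlgebra

/-! ### Vector fields as derivations -/

section Derivation

variable {E : Type*} [NormedAddCommGroup E] [NormedSpace ℝ E]
  {H : Type*} [TopologicalSpace H] {I : ModelWithCorners ℝ E H}
  {M : Type*} [TopologicalSpace M] [ChartedSpace H M]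

theorem differential_apply (F : M → ℝ) (x : M) (v : TangentSpace I x) :
    differential I F x v = (mfderiv I 𝓘(ℝ, ℝ) F x v : ℝ) := rfl

theorem mdifferentiableAt_of_comp_extChartAt_symm [IsManifold I 1 M] {F : M → ℝ} {x : M}
    (hF : DifferentiableAt ℝ (F ∘ (extChartAt I x).symm) (extChartAt I x x)) :
    MDifferentiableAt I 𝓘(ℝ, ℝ) F x := by
  rw [← mdifferentiableWithinAt_univ]
  apply DifferentiableWithinAt.mdifferentiableWithinAt_of_comp_extChartAt_symm
  exact hF.differentiableWithinAt

theorem tendsto_extChartAt_symm (x : M) :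
    Filter.Tendsto (extChartAt I x).symm (𝓝 (extChartAt I x x)) (𝓝 x) := by
  have := continuousAt_extChartAt_symm (I := I) x
  rwa [ContinuousAt, extChartAt_to_inv] at this

variable [I.Boundaryless]

theorem contDiffAt_comp_extChartAt_symm {F : M → ℝ} {x : M}
    (hF : ContMDiffAt I 𝓘(ℝ, ℝ) 2 F x) :
    ContDiffAt ℝ 2 (F ∘ (extChartAt I x).symm) (extChartAt I x x) := by
  have := (contMDiffAt_iff.1 hF).2
  rw [I.range_eq_univ, contDiffWithinAt_univ] at this
  exact this

variable [IsManifold I ∞ M]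

theorem fderiv_comp_extChartAt_symm_mpullbackWithin {F : M → ℝ} {x : M} {u : E}
    (hu : u ∈ (extChartAt I x).target)
    (hF : MDifferentiableAt I 𝓘(ℝ, ℝ) F ((extChartAt I x).symm u))
    (V : ∀ y : M, TangentSpace I y) :
    fderiv ℝ (F ∘ (extChartAt I x).symm) u
        (mpullbackWithin 𝓘(ℝ, E) I (extChartAt I x).symm V (Set.range I) u) =
      differential I F ((extChartAt I x).symm u) (V ((extChartAt I x).symm u)) := by
  have hi := isInvertible_mfderivWithin_extChartAt_symm (I := I) (x := x) hu
  have hs : MDifferentiableWithinAt 𝓘(ℝ, E) I (extChartAt I x).symm (Set.range I) u :=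
    (contMDiffWithinAt_extChartAt_symm_range (n := 1) x hu).mdifferentiableWithinAt (by simp)
  have hc := mfderiv_comp_mfderivWithin u hF hs (I.uniqueMDiffOn u (by simp [I.range_eq_univ]))
  rw [I.range_eq_univ, mfderivWithin_univ, mfderiv_eq_fderiv, ← I.range_eq_univ] at hc
  have h2 := congrArg (fun A => A (mpullbackWithin 𝓘(ℝ, E) I (extChartAt I x).symm V
    (Set.range I) u)) hc
  refine h2.trans ?_
  exact congrArg (mfderiv I 𝓘(ℝ, ℝ) F ((extChartAt I x).symm u))
    (hi.self_apply_inverse (V ((extChartAt I x).symm u)))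

theorem differential_eq_fderiv_comp_extChartAt_symm {F : M → ℝ} {x : M}
    (hF : MDifferentiableAt I 𝓘(ℝ, ℝ) F x) (V : ∀ y : M, TangentSpace I y) :
    differential I F x (V x) = fderiv ℝ (F ∘ (extChartAt I x).symm) (extChartAt I x x)
        (mpullbackWithin 𝓘(ℝ, E) I (extChartAt I x).symm V (Set.range I) (extChartAt I x x)) := by
  rw [fderiv_comp_extChartAt_symm_mpullbackWithin (mem_extChartAt_target x)
    (by rwa [extChartAt_to_inv]), extChartAt_to_inv]

theorem differentiableAt_mpullbackWithin_extChartAt_symm [CompleteSpace E]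
    {V : ∀ y : M, TangentSpace I y} {x : M}
    (hV : MDifferentiableAt I I.tangent (fun y => (⟨y, V y⟩ : TangentBundle I M)) x) :
    DifferentiableAt ℝ (mpullbackWithin 𝓘(ℝ, E) I (extChartAt I x).symm V (Set.range I))
      (extChartAt I x x) := by
  have h := (hV.mdifferentiableWithinAt (s :=
    Set.univ)).differentiableWithinAt_mpullbackWithin_vectorField
  rw [I.range_eq_univ, Set.preimage_univ, Set.univ_inter] at h
  rw [I.range_eq_univ]
  exact differentiableWithinAt_univ.1 h

theorem eventuallyEq_differential_comp_extChartAt_symm {F : M → ℝ} {x : M}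
    (hF : ContMDiffAt I 𝓘(ℝ, ℝ) 2 F x) (V : ∀ y : M, TangentSpace I y) :
    (fun y => differential I F y (V y)) ∘ (extChartAt I x).symm =ᶠ[𝓝 (extChartAt I x x)]
      fun u => fderiv ℝ (F ∘ (extChartAt I x).symm) u
        (mpullbackWithin 𝓘(ℝ, E) I (extChartAt I x).symm V (Set.range I) u) := by
  have h1 : ∀ᶠ y in 𝓝 x, MDifferentiableAt I 𝓘(ℝ, ℝ) F y :=
    ((contMDiffAt_iff_contMDiffAt_nhds (by simp)).1 hF).mono fun y hy => hy.mdifferentiableAt (by simp)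
  filter_upwards [(tendsto_extChartAt_symm x).eventually h1, extChartAt_target_mem_nhds (I := I) x] with u hu ht
  exact (fderiv_comp_extChartAt_symm_mpullbackWithin ht hu V).symm

theorem mdifferentiableAt_differential_apply [CompleteSpace E] {F : M → ℝ} {x : M}
    {V : ∀ y : M, TangentSpace I y} (hF : ContMDiffAt I 𝓘(ℝ, ℝ) 2 F x)
    (hV : MDifferentiableAt I I.tangent (fun y => (⟨y, V y⟩ : TangentBundle I M)) x) :
    MDifferentiableAt I 𝓘(ℝ, ℝ) (fun y => differential I F y (V y)) x := by
  have hd : DifferentiableAt ℝ (fun u => fderiv ℝ (F ∘ (extChartAt I x).symm) u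
        (mpullbackWithin 𝓘(ℝ, E) I (extChartAt I x).symm V (Set.range I) u))
        (extChartAt I x x) :=
    (((contDiffAt_comp_extChartAt_symm hF).fderiv_right
      (m := 1) (by norm_num)).differentiableAt (by simp)).clm_apply
      (differentiableAt_mpullbackWithin_extChartAt_symm hV)
  exact mdifferentiableAt_of_comp_extChartAt_symm
    (hd.congr_of_eventuallyEq (eventuallyEq_differential_comp_extChartAt_symm hF V))

/-- The Lie bracket of vector fields acts on functions as the commutator of derivations. -/
theorem differential_mlieBracket [CompleteSpace E] {F : M → ℝ} {x : M}
    {V W : ∀ y : M, TangentSpace I y} (hF : ContMDiffAt I 𝓘(ℝ, ℝ) 2 F x)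
    (hV : MDifferentiableAt I I.tangent (fun y => (⟨y, V y⟩ : TangentBundle I M)) x)
    (hW : MDifferentiableAt I I.tangent (fun y => (⟨y, W y⟩ : TangentBundle I M)) x) :
    differential I F x (mlieBracket I V W x) =
      differential I (fun y => differential I F y (W y)) x (V x) -
        differential I (fun y => differential I F y (V y)) x (W x) := by
  rw [differential_eq_fderiv_comp_extChartAt_symm (mdifferentiableAt_differential_apply hF hW) V,
    differential_eq_fderiv_comp_extChartAt_symm (mdifferentiableAt_differential_apply hF hV) W,
    (eventuallyEq_differential_comp_extChartAt_symm hF V).fderiv_eq,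
    (eventuallyEq_differential_comp_extChartAt_symm hF W).fderiv_eq,
    ← fderiv_apply_lieBracket (contDiffAt_comp_extChartAt_symm hF) (by simp)
      (differentiableAt_mpullbackWithin_extChartAt_symm hW)
      (differentiableAt_mpullbackWithin_extChartAt_symm hV)]
  have hb : mlieBracket I V W x = (mfderiv I 𝓘(ℝ, E) (extChartAt I x) x).inverse
      (lieBracket ℝ (E := E)
        (mpullbackWithin 𝓘(ℝ, E) I (extChartAt I x).symm V (Set.range I))
        (mpullbackWithin 𝓘(ℝ, E) I (extChartAt I x).symm W (Set.range I))
        (extChartAt I x x)) := by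
    rw [← mlieBracketWithin_univ, mlieBracketWithin_apply, I.range_eq_univ, Set.preimage_univ,
      Set.univ_inter]
    exact congrArg (mfderiv I 𝓘(ℝ, E) (extChartAt I x) x).inverse
      (congrFun (lieBracketWithin_univ (𝕜 := ℝ) (E := E)) _)
  have hFd : MDifferentiableAt I 𝓘(ℝ, ℝ) F x := hF.mdifferentiableAt (by simp)
  have hc : F =ᶠ[𝓝 x] (F ∘ (extChartAt I x).symm) ∘ extChartAt I x := by
    filter_upwards [extChartAt_source_mem_nhds (I := I) x] with y hy
    exact (congrArg F ((extChartAt I x).left_inv hy)).symm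
  have hF' : MDifferentiableAt 𝓘(ℝ, E) 𝓘(ℝ, ℝ) (F ∘ (extChartAt I x).symm) (extChartAt I x x) :=
    ((contDiffAt_comp_extChartAt_symm hF).differentiableAt (by simp)).mdifferentiableAt
  have hm := mfderiv_comp x hF' (mdifferentiableAt_extChartAt (mem_chart_source H x))
  rw [← hc.mfderiv_eq, mfderiv_eq_fderiv] at hm
  rw [hb, differential_apply, hm]
  exact congrArg (fderiv ℝ (F ∘ (extChartAt I x).symm) (extChartAt I x x))
    ((isInvertible_mfderiv_extChartAt (mem_extChartAt_source x)).self_apply_inverse _)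

end Derivation

section MixedPartials

variable {E : Type*} [NormedAddCommGroup E] [NormedSpace ℝ E]
  {H : Type*} [TopologicalSpace H] {I : ModelWithCorners ℝ E H}
  {M : Type*} [TopologicalSpace M] [ChartedSpace H M]
  {E' : Type*} [NormedAddCommGroup E'] [NormedSpace ℝ E']
  {H' : Type*} [TopologicalSpace H'] {I' : ModelWithCorners ℝ E' H'}
  {N : Type*} [TopologicalSpace N] [ChartedSpace H' N]

theorem differential_eq_fderiv [I.Boundaryless] {F : M → ℝ} {x : M} (hF : MDifferentiableAt I 𝓘(ℝ, ℝ) F x)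
    (v : E) :
    differential I F x v = fderiv ℝ (F ∘ (extChartAt I x).symm) (extChartAt I x x) v := by
  have h := hF.mvfderiv
  rw [I.range_eq_univ, fderivWithin_univ] at h
  exact congrArg (fun A : E →L[ℝ] ℝ => A v) h

variable [I.Boundaryless] [I'.Boundaryless] [IsManifold I ∞ M] [IsManifold I' ∞ N]

theorem differential_partial_snd {Φ : M × N → ℝ} {a : M} {b : N}
    (hΦ : ContMDiffAt (I.prod I') 𝓘(ℝ, ℝ) 2 Φ (a, b)) (w : E') :
    (fun x => differential I' (fun y => Φ (x, y)) b w) ∘ (extChartAt I a).symm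
      =ᶠ[𝓝 (extChartAt I a a)] fun u =>
        fderiv ℝ (Φ ∘ (extChartAt (I.prod I') (a, b)).symm) (u, extChartAt I' b b)
          ((0 : E), w) := by
  have hΨ := contDiffAt_comp_extChartAt_symm hΦ
  have h1 : ∀ᶠ q in 𝓝 (a, b), MDifferentiableAt (I.prod I') 𝓘(ℝ, ℝ) Φ q :=
    ((contMDiffAt_iff_contMDiffAt_nhds (by simp)).1 hΦ).mono
      fun y hy => hy.mdifferentiableAt (by simp)
  have h2 : ∀ᶠ p in 𝓝 (extChartAt (I.prod I') (a, b) (a, b)),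
      DifferentiableAt ℝ (Φ ∘ (extChartAt (I.prod I') (a, b)).symm) p :=
    ((hΨ.eventually (by simp)).mono fun p hp => hp.differentiableAt (by simp))
  have ht : Filter.Tendsto (fun x : M => (x, b)) (𝓝 a) (𝓝 (a, b)) :=
    (Continuous.prodMk_left b).tendsto a
  have ht' : Filter.Tendsto (fun u : E => (u, extChartAt I' b b)) (𝓝 (extChartAt I a a))
      (𝓝 (extChartAt (I.prod I') (a, b) (a, b))) := by
    have := (Continuous.prodMk_left (X := E) (extChartAt I' b b)).tendsto (extChartAt I a a)
    simpa [extChartAt_prod] using this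
  filter_upwards [(tendsto_extChartAt_symm a).eventually (ht.eventually h1),
    ht'.eventually h2] with u hu hu'
  have hy : MDifferentiableAt I' 𝓘(ℝ, ℝ) (fun y => Φ ((extChartAt I a).symm u, y)) b :=
    hu.comp b (mdifferentiableAt_const.prodMk mdifferentiableAt_id)
  rw [Function.comp_apply, differential_eq_fderiv hy]
  have hcomp : (fun y => Φ ((extChartAt I a).symm u, y)) ∘ (extChartAt I' b).symm
      = (Φ ∘ (extChartAt (I.prod I') (a, b)).symm) ∘ fun s => (u, s) := by
    rw [extChartAt_prod]
    rfl
  have hs : HasFDerivAt (fun s : E' => (u, s)) (ContinuousLinearMap.inr ℝ E E')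
    (extChartAt I' b b) := hasFDerivAt_prodMk_right u _
  rw [hcomp, (hu'.hasFDerivAt.comp (f := fun s : E' => (u, s)) (extChartAt I' b b) hs).fderiv]
  rfl

theorem differential_partial_fst {Φ : M × N → ℝ} {a : M} {b : N}
    (hΦ : ContMDiffAt (I.prod I') 𝓘(ℝ, ℝ) 2 Φ (a, b)) (v : E) :
    (fun y => differential I (fun x => Φ (x, y)) a v) ∘ (extChartAt I' b).symm
      =ᶠ[𝓝 (extChartAt I' b b)] fun u =>
        fderiv ℝ (Φ ∘ (extChartAt (I.prod I') (a, b)).symm) (extChartAt I a a, u)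
          (v, (0 : E')) := by
  have hΨ := contDiffAt_comp_extChartAt_symm hΦ
  have h1 : ∀ᶠ q in 𝓝 (a, b), MDifferentiableAt (I.prod I') 𝓘(ℝ, ℝ) Φ q :=
    ((contMDiffAt_iff_contMDiffAt_nhds (by simp)).1 hΦ).mono
      fun y hy => hy.mdifferentiableAt (by simp)
  have h2 : ∀ᶠ p in 𝓝 (extChartAt (I.prod I') (a, b) (a, b)),
      DifferentiableAt ℝ (Φ ∘ (extChartAt (I.prod I') (a, b)).symm) p :=
    ((hΨ.eventually (by simp)).mono fun p hp => hp.differentiableAt (by simp))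
  have ht : Filter.Tendsto (fun x : N => (a, x)) (𝓝 b) (𝓝 (a, b)) :=
    (Continuous.prodMk_right a).tendsto b
  have ht' : Filter.Tendsto (fun u : E' => (extChartAt I a a, u)) (𝓝 (extChartAt I' b b))
      (𝓝 (extChartAt (I.prod I') (a, b) (a, b))) := by
    have := (Continuous.prodMk_right (Y := E') (extChartAt I a a)).tendsto (extChartAt I' b b)
    simpa [extChartAt_prod] using this
  filter_upwards [(tendsto_extChartAt_symm b).eventually (ht.eventually h1),
    ht'.eventually h2] with u hu hu'
  have hy : MDifferentiableAt I 𝓘(ℝ, ℝ) (fun x => Φ (x, (extChartAt I' b).symm u)) a :=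
    hu.comp a (mdifferentiableAt_id.prodMk mdifferentiableAt_const)
  rw [Function.comp_apply, differential_eq_fderiv hy]
  have hcomp : (fun x => Φ (x, (extChartAt I' b).symm u)) ∘ (extChartAt I a).symm
      = (Φ ∘ (extChartAt (I.prod I') (a, b)).symm) ∘ fun s : E => (s, u) := by
    rw [extChartAt_prod]
    rfl
  have hs : HasFDerivAt (fun s : E => (s, u)) (ContinuousLinearMap.inl ℝ E E')
    (extChartAt I a a) := hasFDerivAt_prodMk_left _ u
  rw [hcomp, (hu'.hasFDerivAt.comp (f := fun s : E => (s, u)) (extChartAt I a a) hs).fderiv]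
  rfl

/-- Partial derivatives in the two factors of a product commute. -/
theorem differential_differential_comm {Φ : M × N → ℝ} {a : M} {b : N}
    (hΦ : ContMDiffAt (I.prod I') 𝓘(ℝ, ℝ) 2 Φ (a, b)) (v : E)
    (w : E') :
    differential I (fun x => differential I' (fun y => Φ (x, y)) b w) a v =
      differential I' (fun y => differential I (fun x => Φ (x, y)) a v) b w := by
  have hΨ := contDiffAt_comp_extChartAt_symm hΦ
  have hp : extChartAt (I.prod I') (a, b) (a, b) = (extChartAt I a a, extChartAt I' b b) := by
    rw [extChartAt_prod]
    rfl
  rw [hp] at hΨ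
  have hd : DifferentiableAt ℝ (fderiv ℝ (Φ ∘ (extChartAt (I.prod I') (a, b)).symm))
      (extChartAt I a a, extChartAt I' b b) :=
    (hΨ.fderiv_right (m := 1) (by norm_num)).differentiableAt (by simp)
  have hc (z : E × E') : HasFDerivAt
      (fun p => fderiv ℝ (Φ ∘ (extChartAt (I.prod I') (a, b)).symm) p z)
      ((fderiv ℝ (fderiv ℝ (Φ ∘ (extChartAt (I.prod I') (a, b)).symm))
        (extChartAt I a a, extChartAt I' b b)).flip z) (extChartAt I a a, extChartAt I' b b) := by
    simpa using hd.hasFDerivAt.clm_apply (hasFDerivAt_const z _)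
  have h1 := (hc ((0 : E), w)).comp (f := fun u : E => (u, extChartAt I' b b))
    (extChartAt I a a) (hasFDerivAt_prodMk_left _ _)
  have h2 := (hc (v, (0 : E'))).comp (f := fun u : E' => (extChartAt I a a, u))
    (extChartAt I' b b) (hasFDerivAt_prodMk_right _ _)
  have e1 := differential_partial_snd hΦ w
  have e2 := differential_partial_fst hΦ v
  rw [differential_eq_fderiv (mdifferentiableAt_of_comp_extChartAt_symm
      (h1.differentiableAt.congr_of_eventuallyEq e1)),
    differential_eq_fderiv (mdifferentiableAt_of_comp_extChartAt_symm
      (h2.differentiableAt.congr_of_eventuallyEq e2)),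
    e1.fderiv_eq, e2.fderiv_eq]
  refine (congrArg (fun A : E →L[ℝ] ℝ => A v) h1.fderiv).trans (Eq.trans ?_
    (congrArg (fun A : E' →L[ℝ] ℝ => A w) h2.fderiv).symm)
  exact (hΨ.isSymmSndFDerivAt (by simp)) (v, (0 : E')) ((0 : E), w)

end MixedPartials

/-! ### Translations on a Lie group -/

section Translations

variable {E : Type*} [NormedAddCommGroup E] [NormedSpace ℝ E]
  {H : Type*} [TopologicalSpace H] {I : ModelWithCorners ℝ E H}
  {G : Type*} [TopologicalSpace G] [ChartedSpace H G]

theorem mfderiv_mfderiv_apply {f g h : G → G} {x y : G} (hg : MDifferentiableAt I I g y)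
    (hf : MDifferentiableAt I I f x) (hy : f x = y) (hh : ∀ z, g (f z) = h z) (v : E) :
    (mfderiv I I g y (mfderiv I I f x v : E) : E) = (mfderiv I I h x v : E) := by
  subst hy
  obtain rfl : g ∘ f = h := funext hh
  exact (mfderiv_comp_apply x hg hf v).symm

theorem differential_comp {f : G → G} {F : G → ℝ} {x y : G}
    (hF : MDifferentiableAt I 𝓘(ℝ, ℝ) F y) (hf : MDifferentiableAt I I f x) (hy : f x = y)
    (v : E) :
    differential I (fun z => F (f z)) x v = differential I F y (mfderiv I I f x v : E) := by
  subst hy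
  exact mfderiv_comp_apply x hF hf v

theorem mfderiv_id_apply (x : G) (v : E) :
    (mfderiv I I (fun y : G => y) x v : E) = v := by
  have : mfderiv I I (fun y : G => y) x = ContinuousLinearMap.id ℝ (TangentSpace I x) :=
    mfderiv_id
  rw [this]
  rfl

variable [Group G]

instance instLieGroupMinSmoothness [LieGroup I ∞ G] : LieGroup I (minSmoothness ℝ 3) G :=
  LieGroup.of_le (n := ∞) (by
    rw [minSmoothness_of_isRCLikeNormedField]
    exact WithTop.coe_le_coe.2 (le_top : (3 : ℕ∞) ≤ ⊤))

/-- The right-invariant vector field with value `w` at the identity. -/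
def rightInvariantVectorField (w : GroupLieAlgebra I G) (g : G) : TangentSpace I g :=
  (mfderiv I I (fun x : G => x * g) 1 w : E)

@[simp]
theorem Ad_one (v : GroupLieAlgebra I G) : Ad I (1 : G) v = v := by
  have h : (fun x : G => 1 * x * 1⁻¹) = fun x => x := by funext x; simp
  have h2 : (mfderiv I I (fun x : G => 1 * x * 1⁻¹) 1 v : E) = v := by
    rw [h]; exact mfderiv_id_apply (I := I) 1 v
  exact h2

variable [LieGroup I ∞ G]

theorem mdifferentiableAt_mul_left (g x : G) : MDifferentiableAt I I (fun y : G => g * y) x :=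
  (contMDiff_mul_left (I := I) (n := ∞)).mdifferentiableAt (by simp)

theorem mdifferentiableAt_mul_right (g x : G) : MDifferentiableAt I I (fun y : G => y * g) x :=
  (contMDiff_mul_right (I := I) (n := ∞)).mdifferentiableAt (by simp)

theorem mdifferentiableAt_conj (g h x : G) : MDifferentiableAt I I (fun y : G => g * y * h) x :=
  (mdifferentiableAt_mul_right h (g * x)).comp x (mdifferentiableAt_mul_left g x)

@[simp]
theorem leftTrivialization_mulInvariantVectorField (v : GroupLieAlgebra I G) (g : G) :
    leftTrivialization I g (mulInvariantVectorField v g) = v :=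
  (mfderiv_mfderiv_apply (I := I) (h := fun y => y) (mdifferentiableAt_mul_left g⁻¹ g)
    (mdifferentiableAt_mul_left g 1) (mul_one g) (fun z => inv_mul_cancel_left g z) v).trans
    (mfderiv_id_apply (I := I) 1 v)

@[simp]
theorem mulInvariantVectorField_leftTrivialization (g : G) (X : TangentSpace I g) :
    mulInvariantVectorField (leftTrivialization I g X) g = X :=
  (mfderiv_mfderiv_apply (I := I) (h := fun y => y) (mdifferentiableAt_mul_left g 1)
    (mdifferentiableAt_mul_left g⁻¹ g) (inv_mul_cancel g)
    (fun z => mul_inv_cancel_left g z) X).trans (mfderiv_id_apply (I := I) g X)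

theorem leftTrivialization_rightInvariantVectorField (w : GroupLieAlgebra I G) (g : G) :
    leftTrivialization I g (rightInvariantVectorField w g) = Ad I g⁻¹ w :=
  mfderiv_mfderiv_apply (I := I) (mdifferentiableAt_mul_left g⁻¹ g) (mdifferentiableAt_mul_right g 1)
    (one_mul g) (fun z => by simp [mul_assoc]) w

theorem leftTrivialization_mfderiv_mul_left (g h : G) (v : TangentSpace I h) :
    leftTrivialization I (g * h) (mfderiv I I (fun x : G => g * x) h v) =
      leftTrivialization I h v :=
  mfderiv_mfderiv_apply (I := I) (mdifferentiableAt_mul_left _ _) (mdifferentiableAt_mul_left g h)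
    rfl (fun z => by group) v

theorem leftTrivialization_mfderiv_mul_right (g h : G) (v : TangentSpace I g) :
    leftTrivialization I (g * h) (mfderiv I I (fun x : G => x * h) g v) =
      Ad I h⁻¹ (leftTrivialization I g v) :=
  (mfderiv_mfderiv_apply (I := I) (h := fun x : G => (g * h)⁻¹ * (x * h))
    (mdifferentiableAt_mul_left _ _) (mdifferentiableAt_mul_right h g)
    rfl (fun _ => rfl) v).trans
  (mfderiv_mfderiv_apply (I := I) (h := fun x : G => (g * h)⁻¹ * (x * h)) (mdifferentiableAt_conj _ _ _)
    (mdifferentiableAt_mul_left g⁻¹ g) (inv_mul_cancel g) (fun z => by group) v).symm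

theorem Ad_mul (g h : G) (v : GroupLieAlgebra I G) : Ad I (g * h) v = Ad I g (Ad I h v) :=
  (mfderiv_mfderiv_apply (I := I) (mdifferentiableAt_conj g g⁻¹ 1) (mdifferentiableAt_conj h h⁻¹ 1)
    (by simp) (fun z => by group) v).symm

theorem Ad_inv_Ad (g : G) (v : GroupLieAlgebra I G) : Ad I g⁻¹ (Ad I g v) = v := by
  rw [← Ad_mul, inv_mul_cancel, Ad_one]

theorem Ad_Ad_inv (g : G) (v : GroupLieAlgebra I G) : Ad I g (Ad I g⁻¹ v) = v := by
  rw [← Ad_mul, mul_inv_cancel, Ad_one]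

/-- Left-invariant vector fields are smooth. -/
theorem isSmoothVectorField_mulInvariantVectorField (v : GroupLieAlgebra I G) :
    IsSmoothVectorField I (mulInvariantVectorField (G := G) v) := by
  let fg : G → TangentBundle I G := fun g => ⟨g, (0 : E)⟩
  have sfg : ContMDiff I I.tangent ∞ fg := Bundle.contMDiff_zeroSection ℝ (TangentSpace I)
  let fv : G → TangentBundle I G := fun _ => ⟨1, v⟩
  have sfv : ContMDiff I I.tangent ∞ fv := contMDiff_const
  have hm : ContMDiff (I.prod I).tangent I.tangent ∞
      (tangentMap (I.prod I) I (fun p : G × G => p.1 * p.2)) :=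
    (contMDiff_mul I ∞).contMDiff_tangentMap (by simp)
  have hS := hm.comp ((contMDiff_equivTangentBundleProd_symm (n := ∞)).comp (sfg.prodMk sfv))
  unfold IsSmoothVectorField
  convert hS using 1
  funext g
  have hd := mfderiv_prod_eq_add_apply (I := I) (I' := I) (I'' := I)
    (f := fun p : G × G => p.1 * p.2) (p := (g, 1)) (v := ((0 : E), (v : E)))
    ((contMDiff_mul I ∞).mdifferentiableAt (by simp))
  have hd' : (mfderiv (I.prod I) I (fun p : G × G => p.1 * p.2) (g, 1) ((0 : E), (v : E)) : E)
      = mulInvariantVectorField v g := by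
    refine Eq.trans hd ?_
    have : mfderiv I I (fun z : G => z * 1) g (0 : TangentSpace I g) = 0 := map_zero _
    exact (congrArg (· + (mulInvariantVectorField v g : E)) this).trans (zero_add _)
  have key : ∀ (a b : G) (u v : E), a = b → u = v →
      (⟨a, u⟩ : TangentBundle I G) = ⟨b, v⟩ := by
    rintro a _ u _ rfl rfl; rfl
  exact key _ _ _ _ (mul_one g).symm hd'.symm

/-- Right-invariant vector fields are smooth. -/
theorem isSmoothVectorField_rightInvariantVectorField (w : GroupLieAlgebra I G) :
    IsSmoothVectorField I (rightInvariantVectorField (G := G) w) := by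
  let fg : G → TangentBundle I G := fun g => ⟨g, (0 : E)⟩
  have sfg : ContMDiff I I.tangent ∞ fg := Bundle.contMDiff_zeroSection ℝ (TangentSpace I)
  let fw : G → TangentBundle I G := fun _ => ⟨1, w⟩
  have sfw : ContMDiff I I.tangent ∞ fw := contMDiff_const
  have hm : ContMDiff (I.prod I).tangent I.tangent ∞
      (tangentMap (I.prod I) I (fun p : G × G => p.1 * p.2)) :=
    (contMDiff_mul I ∞).contMDiff_tangentMap (by simp)
  have hS := hm.comp ((contMDiff_equivTangentBundleProd_symm (n := ∞)).comp (sfw.prodMk sfg))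
  unfold IsSmoothVectorField
  convert hS using 1
  funext g
  have hd := mfderiv_prod_eq_add_apply (I := I) (I' := I) (I'' := I)
    (f := fun p : G × G => p.1 * p.2) (p := (1, g)) (v := ((w : E), (0 : E)))
    ((contMDiff_mul I ∞).mdifferentiableAt (by simp))
  have hd' : (mfderiv (I.prod I) I (fun p : G × G => p.1 * p.2) (1, g) ((w : E), (0 : E)) : E)
      = rightInvariantVectorField w g := by
    refine Eq.trans hd ?_
    have : mfderiv I I (fun z : G => 1 * z) g (0 : TangentSpace I g) = 0 := map_zero _
    exact (congrArg ((rightInvariantVectorField w g : E) + ·) this).trans (add_zero _)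
  have key : ∀ (a b : G) (u v : E), a = b → u = v →
      (⟨a, u⟩ : TangentBundle I G) = ⟨b, v⟩ := by
    rintro a _ u _ rfl rfl; rfl
  exact key _ _ _ _ (one_mul g).symm hd'.symm

end Translations

/-! ### Calculus of real functions on a manifold -/

section Calculus

variable {E : Type*} [NormedAddCommGroup E] [NormedSpace ℝ E]
  {H : Type*} [TopologicalSpace H] {I : ModelWithCorners ℝ E H}
  {M : Type*} [TopologicalSpace M] [ChartedSpace H M]

theorem differential_mul {F K : M → ℝ} {x : M} (hF : MDifferentiableAt I 𝓘(ℝ, ℝ) F x)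
    (hK : MDifferentiableAt I 𝓘(ℝ, ℝ) K x) (v : TangentSpace I x) :
    differential I (fun y => F y * K y) x v =
      F x * differential I K x v + K x * differential I F x v := by
  simp [differential, mvfderiv_fun_mul hF hK]

theorem differential_const (c : ℝ) (x : M) (v : TangentSpace I x) :
    differential I (fun _ : M => c) x v = 0 := by
  simp [differential, mvfderiv_const]

theorem mdifferentiableAt_fun_mul {F K : M → ℝ} {x : M} (hF : MDifferentiableAt I 𝓘(ℝ, ℝ) F x)
    (hK : MDifferentiableAt I 𝓘(ℝ, ℝ) K x) :
    MDifferentiableAt I 𝓘(ℝ, ℝ) (fun y => F y * K y) x :=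
  hF.mul hK

theorem mdifferentiableAt_fun_add {F K : M → ℝ} {x : M} (hF : MDifferentiableAt I 𝓘(ℝ, ℝ) F x)
    (hK : MDifferentiableAt I 𝓘(ℝ, ℝ) K x) :
    MDifferentiableAt I 𝓘(ℝ, ℝ) (fun y => F y + K y) x :=
  hF.add hK

theorem mdifferentiableAt_fun_sum {ι : Type*} {s : Finset ι} {F : ι → M → ℝ} {x : M}
    (hF : ∀ i ∈ s, MDifferentiableAt I 𝓘(ℝ, ℝ) (F i) x) :
    MDifferentiableAt I 𝓘(ℝ, ℝ) (fun y => ∑ i ∈ s, F i y) x := by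
  classical
  induction s using Finset.induction_on with
  | empty => simpa using mdifferentiableAt_const
  | insert i s hi ih =>
    simp only [Finset.sum_insert hi]
    exact mdifferentiableAt_fun_add (hF i (by simp)) (ih fun j hj => hF j (by simp [hj]))

theorem mdifferentiableAt_fun_prod {ι : Type*} {s : Finset ι} {F : ι → M → ℝ} {x : M}
    (hF : ∀ i ∈ s, MDifferentiableAt I 𝓘(ℝ, ℝ) (F i) x) :
    MDifferentiableAt I 𝓘(ℝ, ℝ) (fun y => ∏ i ∈ s, F i y) x := by
  classical
  induction s using Finset.induction_on with
  | empty => simpa using mdifferentiableAt_const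
  | insert i s hi ih =>
    simp only [Finset.prod_insert hi]
    exact mdifferentiableAt_fun_mul (hF i (by simp)) (ih fun j hj => hF j (by simp [hj]))

theorem differential_sum {ι : Type*} {s : Finset ι} {F : ι → M → ℝ} {x : M}
    (hF : ∀ i ∈ s, MDifferentiableAt I 𝓘(ℝ, ℝ) (F i) x) (v : TangentSpace I x) :
    differential I (fun y => ∑ i ∈ s, F i y) x v = ∑ i ∈ s, differential I (F i) x v := by
  classical
  induction s using Finset.induction_on with
  | empty => simpa using differential_const 0 x v
  | insert i s hi ih =>
    simp only [Finset.sum_insert hi]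
    rw [differential_add I (hF i (by simp))
      (mdifferentiableAt_fun_sum fun j hj => hF j (by simp [hj])), LinearMap.add_apply,
      ih fun j hj => hF j (by simp [hj])]

theorem differential_prod {ι : Type*} [DecidableEq ι] {s : Finset ι} {F : ι → M → ℝ} {x : M}
    (hF : ∀ i ∈ s, MDifferentiableAt I 𝓘(ℝ, ℝ) (F i) x) (v : TangentSpace I x) :
    differential I (fun y => ∏ i ∈ s, F i y) x v =
      ∑ i ∈ s, (∏ j ∈ s.erase i, F j x) * differential I (F i) x v := by
  induction s using Finset.induction_on with
  | empty => simpa using differential_const 1 x v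
  | insert i s hi ih =>
    simp only [Finset.prod_insert hi, Finset.sum_insert hi, Finset.erase_insert hi]
    rw [differential_mul (hF i (by simp))
      (mdifferentiableAt_fun_prod fun j hj => hF j (by simp [hj])),
      ih fun j hj => hF j (by simp [hj]), add_comm, Finset.mul_sum]
    congr 1
    refine Finset.sum_congr rfl fun j hj => ?_
    have hij : i ≠ j := fun h => hi (h ▸ hj)
    rw [Finset.erase_insert_of_ne hij, Finset.prod_insert (by simp [hi]), mul_assoc]

variable {V : Type*} [AddCommGroup V] [Module ℝ V] {ι : Type*} [Fintype ι] {n : ℕ}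

theorem alternatingMap_eq_sum_basis (b : Basis ι ℝ V) (ν : V [⋀^Fin n]→ₗ[ℝ] ℝ) (y : Fin n → V) :
    ν y = ∑ s : Fin n → ι, (∏ i, b.coord (s i) (y i)) * ν (fun i => b (s i)) := by
  classical
  have h : y = fun i => ∑ k, b.coord k (y i) • b k := by
    funext i
    simp
  have h2 := ν.toMultilinearMap.map_sum (fun i k => b.coord k (y i) • b k)
  conv_lhs => rw [h]
  refine h2.trans (Finset.sum_congr rfl fun s _ => ?_)
  have := ν.toMultilinearMap.map_smul_univ (fun i => b.coord (s i) (y i)) (fun i => b (s i))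
  simpa using this

theorem contMDiff_alternatingMap [FiniteDimensional ℝ V] (ν : V [⋀^Fin n]→ₗ[ℝ] ℝ)
    {y : Fin n → M → V}
    (hy : ∀ i (α : Dual ℝ V), ContMDiff I 𝓘(ℝ, ℝ) ∞ (fun x => α (y i x))) :
    ContMDiff I 𝓘(ℝ, ℝ) ∞ (fun x => ν (fun i => y i x)) := by
  rw [funext fun x => alternatingMap_eq_sum_basis (finBasis ℝ V) ν fun i => y i x]
  refine contMDiff_finsetSum fun s _ => ContMDiff.mul ?_ contMDiff_const
  exact contMDiff_finsetProd fun i _ => hy i _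

/-- The product rule for a form evaluated on vector-valued functions. -/
theorem differential_alternatingMap [FiniteDimensional ℝ V] (ν : V [⋀^Fin n]→ₗ[ℝ] ℝ)
    {y : Fin n → M → V} {x : M} {v : TangentSpace I x} {z : Fin n → V}
    (hy : ∀ i (α : Dual ℝ V), MDifferentiableAt I 𝓘(ℝ, ℝ) (fun x => α (y i x)) x)
    (hz : ∀ i (α : Dual ℝ V), differential I (fun x => α (y i x)) x v = α (z i)) :
    differential I (fun x => ν (fun i => y i x)) x v =
      ∑ i, ν (Function.update (fun j => y j x) i (z i)) := by
  classical
  let b := finBasis ℝ V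
  have hp : ∀ s : Fin n → Fin (finrank ℝ V), MDifferentiableAt I 𝓘(ℝ, ℝ)
      (fun x => ∏ i, b.coord (s i) (y i x)) x :=
    fun s => mdifferentiableAt_fun_prod fun i _ => hy i _
  rw [funext fun x => alternatingMap_eq_sum_basis b ν fun i => y i x,
    Finset.sum_congr rfl fun i _ => alternatingMap_eq_sum_basis b ν
      (Function.update (fun j => y j x) i (z i)),
    differential_sum fun s _ => mdifferentiableAt_fun_mul (hp s) mdifferentiableAt_const,
    Finset.sum_comm]
  refine Finset.sum_congr rfl fun s _ => ?_
  rw [differential_mul (hp s) mdifferentiableAt_const, differential_const, mul_zero, zero_add,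
    differential_prod fun i _ => hy i _, mul_comm, Finset.sum_mul]
  refine Finset.sum_congr rfl fun i _ => ?_
  rw [hz, ← Finset.mul_prod_erase _ _ (Finset.mem_univ i), Function.update_self,
    mul_comm (b.coord (s i) (z i))]
  congr 2
  refine Finset.prod_congr rfl fun j hj => ?_
  rw [Function.update_of_ne (Finset.ne_of_mem_erase hj)]

end Calculus

/-! ### The Lie bracket in the left trivialization -/

section Frame

theorem dual_eq_sum_coord {V : Type*} [AddCommGroup V] [Module ℝ V] {ι : Type*} [Fintype ι]
    (b : Basis ι ℝ V) (α : Dual ℝ V) (x : V) : α x = ∑ j, b.coord j x * α (b j) := by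
  conv_lhs => rw [← b.sum_repr x, map_sum]
  simp only [map_smul, smul_eq_mul, Basis.coord_apply]

variable {E : Type*} [NormedAddCommGroup E] [NormedSpace ℝ E]
  {H : Type*} [TopologicalSpace H] {I : ModelWithCorners ℝ E H}

theorem differential_dual_eq_sum_coord {M : Type*} [TopologicalSpace M] [ChartedSpace H M]
    {V : Type*} [AddCommGroup V] [Module ℝ V] {ι : Type*} [Fintype ι] (b : Basis ι ℝ V)
    {X : M → V} {x : M} (hX : ∀ α : Dual ℝ V, MDifferentiableAt I 𝓘(ℝ, ℝ) (fun y => α (X y)) x)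
    (α : Dual ℝ V) (v : TangentSpace I x) :
    differential I (fun y => α (X y)) x v =
      ∑ j, differential I (fun y => b.coord j (X y)) x v * α (b j) := by
  rw [funext fun y => dual_eq_sum_coord b α (X y),
    differential_sum fun j _ => mdifferentiableAt_fun_mul (hX _) mdifferentiableAt_const]
  refine Finset.sum_congr rfl fun j _ => ?_
  rw [differential_mul (hX _) mdifferentiableAt_const, differential_const]
  ring

variable {G : Type*} [TopologicalSpace G] [ChartedSpace H G] [Group G]

theorem mulInvariantVectorField_sum_smul {ι : Type*} (s : Finset ι) (c : ι → ℝ)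
    (v : ι → GroupLieAlgebra I G) (g : G) :
    mulInvariantVectorField (∑ j ∈ s, c j • v j) g =
      ∑ j ∈ s, c j • mulInvariantVectorField (v j) g := by
  classical
  induction s using Finset.induction_on with
  | empty =>
    rw [Finset.sum_empty, Finset.sum_empty]
    exact map_zero (mfderiv I I (fun x : G => g * x) 1)
  | insert i s hi ih =>
    rw [Finset.sum_insert hi, Finset.sum_insert hi, mulInvariantVectorField_add,
      mulInvariantVectorField_smul, Pi.add_apply, ih, Pi.smul_apply]

variable [LieGroup I ∞ G]

theorem mdifferentiableAt_section_mulInvariantVectorField (v : GroupLieAlgebra I G) (g : G) :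
    MDifferentiableAt I I.tangent
      (fun y => (⟨y, mulInvariantVectorField v y⟩ : TangentBundle I G)) g :=
  (isSmoothVectorField_mulInvariantVectorField v).mdifferentiableAt (by simp)

theorem eq_sum_mulInvariantVectorField {ι : Type*} [Fintype ι]
    (b : Basis ι ℝ (GroupLieAlgebra I G)) (X : ∀ g : G, TangentSpace I g) :
    X = fun g => ∑ j, b.coord j (leftTrivialization I g (X g)) •
      mulInvariantVectorField (b j) g := by
  funext g
  rw [← mulInvariantVectorField_sum_smul]
  simp only [Basis.coord_apply, b.sum_repr, mulInvariantVectorField_leftTrivialization]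

variable [CompleteSpace E]

theorem mlieBracket_sum_smul_mulInvariantVectorField {ι : Type*} (s : Finset ι)
    {f : ι → G → ℝ} (v : ι → GroupLieAlgebra I G) (X : ∀ g : G, TangentSpace I g) {g : G}
    (hf : ∀ j, MDifferentiableAt I 𝓘(ℝ, ℝ) (f j) g) :
    mlieBracket I X (fun y => ∑ j ∈ s, f j y • mulInvariantVectorField (v j) y) g =
      ∑ j ∈ s, (differential I (f j) g (X g) • mulInvariantVectorField (v j) g +
        f j g • mlieBracket I X (mulInvariantVectorField (v j)) g) := by
  classical
  have hd : ∀ j, MDifferentiableAt I I.tangent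
      (fun y => (⟨y, (f j • mulInvariantVectorField (v j)) y⟩ : TangentBundle I G)) g :=
    fun j => (hf j).smul_section (mdifferentiableAt_section_mulInvariantVectorField (v j) g)
  induction s using Finset.induction_on with
  | empty =>
    simp only [Finset.sum_empty]
    exact congrFun mlieBracket_zero_right g
  | insert i s hi ih =>
    have e : (fun y => ∑ j ∈ insert i s, f j y • mulInvariantVectorField (v j) y) =
        f i • mulInvariantVectorField (v i) +
          fun y => ∑ j ∈ s, f j y • mulInvariantVectorField (v j) y := by
      funext y
      rw [Finset.sum_insert hi]
      rfl
    have hs : MDifferentiableAt I I.tangent (fun y =>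
        (⟨y, ∑ j ∈ s, f j y • mulInvariantVectorField (v j) y⟩ : TangentBundle I G)) g :=
      MDifferentiableAt.sum_section fun j _ => hd j
    rw [e, mlieBracket_add_right (hd i) hs, ih,
      Finset.sum_insert hi,
      mlieBracket_smul_right (hf i) (mdifferentiableAt_section_mulInvariantVectorField (v i) g)]
    rfl

theorem leftTrivialization_mlieBracket_mulInvariantVectorField (v w : GroupLieAlgebra I G)
    (g : G) :
    leftTrivialization I g
      (mlieBracket I (mulInvariantVectorField v) (mulInvariantVectorField w) g) = ⁅v, w⁆ := by
  rw [← mulInvariantVector_mlieBracket, leftTrivialization_mulInvariantVectorField]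
  rfl

theorem dual_leftTrivialization_mlieBracket_eq_add_sum {X Y : ∀ g : G, TangentSpace I g} {g : G}
    (hY : ∀ α : Dual ℝ (GroupLieAlgebra I G),
      MDifferentiableAt I 𝓘(ℝ, ℝ) (fun y => α (leftTrivialization I y (Y y))) g)
    (α : Dual ℝ (GroupLieAlgebra I G)) {ι : Type*} [Fintype ι]
    (b : Basis ι ℝ (GroupLieAlgebra I G)) :
    α (leftTrivialization I g (mlieBracket I X Y g)) =
      differential I (fun y => α (leftTrivialization I y (Y y))) g (X g) +
        ∑ j, b.coord j (leftTrivialization I g (Y g)) *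
          α (leftTrivialization I g (mlieBracket I X (mulInvariantVectorField (b j)) g)) := by
  rw [differential_dual_eq_sum_coord b hY]
  conv_lhs => rw [eq_sum_mulInvariantVectorField b Y]
  rw [mlieBracket_sum_smul_mulInvariantVectorField _ _ _ fun j => hY (b.coord j),
    map_sum, map_sum, ← Finset.sum_add_distrib]
  refine Finset.sum_congr rfl fun j _ => ?_
  simp only [map_add, map_smul, leftTrivialization_mulInvariantVectorField, smul_eq_mul]

variable [FiniteDimensional ℝ E]

/-- The Lie bracket of vector fields in the left trivialization. -/
theorem dual_leftTrivialization_mlieBracket {X Y : ∀ g : G, TangentSpace I g} {g : G}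
    (hX : ∀ α : Dual ℝ (GroupLieAlgebra I G),
      MDifferentiableAt I 𝓘(ℝ, ℝ) (fun y => α (leftTrivialization I y (X y))) g)
    (hY : ∀ α : Dual ℝ (GroupLieAlgebra I G),
      MDifferentiableAt I 𝓘(ℝ, ℝ) (fun y => α (leftTrivialization I y (Y y))) g)
    (α : Dual ℝ (GroupLieAlgebra I G)) :
    α (leftTrivialization I g (mlieBracket I X Y g)) =
      differential I (fun y => α (leftTrivialization I y (Y y))) g (X g) -
        differential I (fun y => α (leftTrivialization I y (X y))) g (Y g) +
        α ⁅leftTrivialization I g (X g), leftTrivialization I g (Y g)⁆ := by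
  let b := finBasis ℝ (GroupLieAlgebra I G)
  have h1 : ∀ v : GroupLieAlgebra I G,
      α (leftTrivialization I g (mlieBracket I X (mulInvariantVectorField v) g)) =
        -differential I (fun y => α (leftTrivialization I y (X y))) g
            (mulInvariantVectorField v g) + α ⁅leftTrivialization I g (X g), v⁆ := by
    intro v
    rw [mlieBracket_swap_apply, map_neg, map_neg,
      dual_leftTrivialization_mlieBracket_eq_add_sum hX α b, neg_add, ← lie_skew, map_neg]
    congr 2
    simp only [leftTrivialization_mlieBracket_mulInvariantVectorField]
    exact (dual_eq_sum_coord b (α ∘ₗ (LieAlgebra.ad ℝ _ v)) (leftTrivialization I g (X g))).symm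
  rw [dual_leftTrivialization_mlieBracket_eq_add_sum hY α b]
  simp only [h1, mul_add, Finset.sum_add_distrib, mul_neg, Finset.sum_neg_distrib]
  have h2 : ∑ j, b.coord j (leftTrivialization I g (Y g)) *
      differential I (fun y => α (leftTrivialization I y (X y))) g
        (mulInvariantVectorField (b j) g) =
      differential I (fun y => α (leftTrivialization I y (X y))) g (Y g) := by
    conv_rhs => rw [congrFun (eq_sum_mulInvariantVectorField b Y) g]
    rw [map_sum]
    simp only [map_smul, smul_eq_mul]
  have h3 : ∑ j, b.coord j (leftTrivialization I g (Y g)) *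
      α ⁅leftTrivialization I g (X g), b j⁆ =
      α ⁅leftTrivialization I g (X g), leftTrivialization I g (Y g)⁆ :=
    (dual_eq_sum_coord b (α ∘ₗ (LieAlgebra.ad ℝ _ (leftTrivialization I g (X g))))
      (leftTrivialization I g (Y g))).symm
  rw [h2, h3]
  ring

end Frame

/-! ### The differential of the adjoint representation -/

section Adjoint

variable {E : Type*} [NormedAddCommGroup E] [NormedSpace ℝ E]
  {H : Type*} [TopologicalSpace H] {I : ModelWithCorners ℝ E H}

theorem differential_congr {M : Type*} [TopologicalSpace M] [ChartedSpace H M] {F K : M → ℝ}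
    {x : M} (h : F =ᶠ[𝓝 x] K) (v : E) : differential I F x v = differential I K x v :=
  congrArg (fun A : E →L[ℝ] ℝ => A v) h.mfderiv_eq

theorem differential_clm_comp_extChartAt [I.Boundaryless] {M : Type*} [TopologicalSpace M]
    [ChartedSpace H M] [IsManifold I ∞ M] (φ : E →L[ℝ] ℝ) (x : M) (v : E) :
    differential I (fun y => φ (extChartAt I x y)) x v = φ v := by
  have hd : MDifferentiableAt I 𝓘(ℝ, ℝ) (fun y => φ (extChartAt I x y)) x :=
    φ.mdifferentiableAt.comp x (mdifferentiableAt_extChartAt (mem_chart_source H x))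
  rw [differential_eq_fderiv hd]
  have he : (fun y => φ (extChartAt I x y)) ∘ (extChartAt I x).symm =ᶠ[𝓝 (extChartAt I x x)] φ := by
    filter_upwards [extChartAt_target_mem_nhds (I := I) x] with u hu
    exact congrArg φ ((extChartAt I x).right_inv hu)
  rw [he.fderiv_eq, φ.fderiv]

variable {G : Type*} [TopologicalSpace G] [ChartedSpace H G] [Group G]

theorem finrank_groupLieAlgebra {n : ℕ} (hn : finrank ℝ E = n) :
    finrank ℝ (GroupLieAlgebra I G) = n := hn

@[simp]
theorem mulInvariantVectorField_one (w : GroupLieAlgebra I G) :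
    mulInvariantVectorField w (1 : G) = w := by
  have h : (fun x : G => 1 * x) = fun x => x := funext one_mul
  have h2 : (mfderiv I I (fun x : G => 1 * x) 1 w : E) = w := by
    rw [h]; exact mfderiv_id_apply (I := I) 1 w
  exact h2

@[simp]
theorem rightInvariantVectorField_one (w : GroupLieAlgebra I G) :
    rightInvariantVectorField w (1 : G) = w := by
  have h : (fun x : G => x * 1) = fun x => x := funext mul_one
  have h2 : (mfderiv I I (fun x : G => x * 1) 1 w : E) = w := by
    rw [h]; exact mfderiv_id_apply (I := I) 1 w
  exact h2

theorem f₀_eq_det [FiniteDimensional ℝ E] {n : ℕ} (hn : finrank ℝ E = n) (g : G) :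
    f₀ I n g = LinearMap.det (Ad I g).toLinearMap :=
  det_exteriorPower_map (finrank_groupLieAlgebra hn) _

theorem f₀_one [FiniteDimensional ℝ E] {n : ℕ} (hn : finrank ℝ E = n) : f₀ I n (1 : G) = 1 := by
  have : (Ad I (1 : G)).toLinearMap = LinearMap.id := by
    ext v
    exact Ad_one v
  rw [f₀_eq_det hn, this, LinearMap.det_id]

theorem f₀_eq_basis_det [FiniteDimensional ℝ E] {n : ℕ} (hn : finrank ℝ E = n)
    (b : Basis (Fin n) ℝ (GroupLieAlgebra I G))
    (g : G) : f₀ I n g = b.det (fun i => Ad I g (b i)) := by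
  have h := alternatingMap_apply_comp (finrank_groupLieAlgebra hn) b.det (Ad I g).toLinearMap b
  rw [f₀_eq_det hn]
  rw [b.det_self, mul_one] at h
  exact h.symm

variable [LieGroup I ∞ G]

theorem mdifferentiableAt_section_rightInvariantVectorField (v : GroupLieAlgebra I G) (g : G) :
    MDifferentiableAt I I.tangent
      (fun y => (⟨y, rightInvariantVectorField v y⟩ : TangentBundle I G)) g :=
  (isSmoothVectorField_rightInvariantVectorField v).mdifferentiableAt (by simp)

theorem differential_leftInvariant_rightInvariant_comm [I.Boundaryless] {F : G → ℝ}
    (hF : ContMDiffAt I 𝓘(ℝ, ℝ) 2 F 1) (v w : GroupLieAlgebra I G) :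
    differential I (fun x => differential I F x (mulInvariantVectorField w x)) 1 v =
      differential I (fun x => differential I F x (rightInvariantVectorField v x)) 1 w := by
  have hd : ∀ᶠ x in 𝓝 (1 : G), MDifferentiableAt I 𝓘(ℝ, ℝ) F x :=
    ((contMDiffAt_iff_contMDiffAt_nhds (by simp)).1 hF).mono
      fun y hy => hy.mdifferentiableAt (by simp)
  have hΦ : ContMDiffAt (I.prod I) 𝓘(ℝ, ℝ) 2 (fun p : G × G => F (p.1 * p.2)) (1, 1) := by
    have hF' : ContMDiffAt I 𝓘(ℝ, ℝ) 2 F ((1 : G) * 1) := by rwa [mul_one]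
    have hm : ContMDiffAt (I.prod I) I 2 (fun p : G × G => p.1 * p.2) (1, 1) :=
      ((contMDiff_mul I ∞).of_le (WithTop.coe_le_coe.2 (le_top : (2 : ℕ∞) ≤ ⊤))) (1, 1)
    exact hF'.comp (1, 1) hm
  have h := differential_differential_comm hΦ v w
  refine Eq.trans ?_ (h.trans ?_)
  · refine differential_congr ?_ _
    filter_upwards [hd] with x hx
    exact (differential_comp (I := I) hx (mdifferentiableAt_mul_left x 1) (mul_one x) w).symm
  · refine differential_congr ?_ _
    filter_upwards [hd] with x hx
    exact differential_comp (I := I) hx (mdifferentiableAt_mul_right x 1) (one_mul x) v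

variable [FiniteDimensional ℝ E] {n : ℕ}

theorem contMDiff_dual_leftTrivialization {Y : ∀ g : G, TangentSpace I g}
    (hY : IsSmoothVectorField I Y) (α : Dual ℝ (GroupLieAlgebra I G)) :
    ContMDiff I 𝓘(ℝ, ℝ) ∞ (fun g => α (leftTrivialization I g (Y g))) :=
  isSmoothOneForm_leftInvariantOneForm α Y hY

theorem contMDiff_Ad_inv (w : GroupLieAlgebra I G)
    (α : Dual ℝ (GroupLieAlgebra I G)) :
    ContMDiff I 𝓘(ℝ, ℝ) ∞ (fun g : G => α (Ad I g⁻¹ w)) := by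
  have := contMDiff_dual_leftTrivialization (isSmoothVectorField_rightInvariantVectorField w) α
  simpa only [leftTrivialization_rightInvariantVectorField] using this

theorem contMDiff_Ad (w : GroupLieAlgebra I G)
    (α : Dual ℝ (GroupLieAlgebra I G)) :
    ContMDiff I 𝓘(ℝ, ℝ) ∞ (fun g : G => α (Ad I g w)) := by
  simpa [Function.comp_def] using (contMDiff_Ad_inv w α).comp (contMDiff_inv I ∞)

theorem f₀_mul (hn : finrank ℝ E = n) (g h : G) : f₀ I n (g * h) = f₀ I n g * f₀ I n h := by
  rw [f₀_eq_det hn, f₀_eq_det hn, f₀_eq_det hn, ← LinearMap.det_comp]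
  congr 1
  ext v
  exact Ad_mul g h v

theorem contMDiff_f₀ (hn : finrank ℝ E = n) : ContMDiff I 𝓘(ℝ, ℝ) ∞ (f₀ I n : G → ℝ) := by
  let b : Basis (Fin n) ℝ (GroupLieAlgebra I G) :=
    finBasisOfFinrankEq ℝ _ (finrank_groupLieAlgebra hn)
  rw [show (f₀ I n : G → ℝ) = _ from funext (f₀_eq_basis_det hn b)]
  exact contMDiff_alternatingMap _ fun i α => contMDiff_Ad (b i) α

theorem f₀_mul_inv (hn : finrank ℝ E = n) (g : G) : f₀ I n g * f₀ I n g⁻¹ = 1 := by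
  rw [← f₀_mul hn, mul_inv_cancel, f₀_one hn]

theorem f₀_pos [ConnectedSpace G] (hn : finrank ℝ E = n) (g : G) : 0 < f₀ I n g := by
  by_contra! hg
  obtain ⟨x, hx⟩ := mem_range_of_exists_le_of_exists_ge (contMDiff_f₀ (I := I) (G := G) hn).continuous
    ⟨g, hg⟩ ⟨1, (f₀_one (I := I) (G := G) hn).symm ▸ zero_le_one⟩
  have := f₀_mul_inv (I := I) hn x
  simp [hx] at this

theorem contMDiff_sqrt_f₀ [ConnectedSpace G] (hn : finrank ℝ E = n) :
    ContMDiff I 𝓘(ℝ, ℝ) ∞ (fun g : G => √(f₀ I n g)) := fun g =>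
  (Real.contDiffAt_sqrt (f₀_pos (I := I) hn g).ne').contMDiffAt.comp g (contMDiff_f₀ hn g)

variable [I.Boundaryless] [CompleteSpace E]

/-- Left- and right-invariant vector fields commute. -/
theorem mlieBracket_mulInvariantVectorField_rightInvariantVectorField_one
    (v w : GroupLieAlgebra I G) :
    mlieBracket I (mulInvariantVectorField v) (rightInvariantVectorField w) (1 : G) = 0 := by
  refine (Module.forall_dual_apply_eq_zero_iff ℝ (V := E) _).1 fun φ => ?_
  let φc : E →L[ℝ] ℝ := LinearMap.toContinuousLinearMap φ
  have hF : ContMDiffAt I 𝓘(ℝ, ℝ) 2 (fun y : G => φc (extChartAt I (1 : G) y)) 1 :=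
    φc.contMDiff.contMDiffAt.comp (1 : G) contMDiffAt_extChartAt
  have h1 := differential_mlieBracket hF (mdifferentiableAt_section_mulInvariantVectorField v 1)
    (mdifferentiableAt_section_rightInvariantVectorField w 1)
  rw [mulInvariantVectorField_one, rightInvariantVectorField_one,
    differential_leftInvariant_rightInvariant_comm hF w v, sub_self] at h1
  exact (differential_clm_comp_extChartAt φc (1 : G) _).symm.trans h1

/-- The differential of the adjoint representation is the adjoint representation of the Lie
algebra. -/
theorem differential_Ad_inv (v w : GroupLieAlgebra I G) (α : Dual ℝ (GroupLieAlgebra I G)) :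
    differential I (fun g : G => α (Ad I g⁻¹ w)) 1 v = -α ⁅v, w⁆ := by
  have hL := fun α : Dual ℝ (GroupLieAlgebra I G) =>
    (contMDiff_dual_leftTrivialization (isSmoothVectorField_mulInvariantVectorField v)
      α).mdifferentiableAt (x := (1 : G)) (by simp)
  have hR := fun α : Dual ℝ (GroupLieAlgebra I G) =>
    (contMDiff_dual_leftTrivialization (isSmoothVectorField_rightInvariantVectorField w)
      α).mdifferentiableAt (x := (1 : G)) (by simp)
  have h := dual_leftTrivialization_mlieBracket hL hR α
  rw [leftTrivialization_mulInvariantVectorField, mlieBracket_mulInvariantVectorField_rightInvariantVectorField_one] at h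
  simp only [leftTrivialization_mulInvariantVectorField, map_zero, differential_const,
    leftTrivialization_rightInvariantVectorField, inv_one, Ad_one,
    mulInvariantVectorField_one, sub_zero] at h
  linarith

theorem differential_f₀_one (hn : finrank ℝ E = n) (v : GroupLieAlgebra I G) :
    differential I (f₀ I n : G → ℝ) 1 v =
      LinearMap.trace ℝ _ (LieAlgebra.ad ℝ (GroupLieAlgebra I G) v) := by
  let b : Basis (Fin n) ℝ (GroupLieAlgebra I G) :=
    finBasisOfFinrankEq ℝ _ (finrank_groupLieAlgebra hn)
  have h1 : differential I (fun g : G => f₀ I n g⁻¹) 1 v =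
      -LinearMap.trace ℝ _ (LieAlgebra.ad ℝ (GroupLieAlgebra I G) v) := by
    rw [show (fun g : G => f₀ I n g⁻¹) = _ from funext fun g => f₀_eq_basis_det hn b g⁻¹,
      differential_alternatingMap b.det (z := fun i => -⁅v, b i⁆)
        (fun i α => (contMDiff_Ad_inv (b i) α).mdifferentiableAt (by simp))
        (fun i α => by rw [differential_Ad_inv, map_neg])]
    have := sum_alternatingMap_update (finrank_groupLieAlgebra hn) b.det
      (-(LieAlgebra.ad ℝ (GroupLieAlgebra I G) v)) b
    rw [b.det_self, mul_one, map_neg] at this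
    simp only [inv_one, Ad_one]
    exact this
  have hd : MDifferentiableAt I 𝓘(ℝ, ℝ) (f₀ I n : G → ℝ) 1 :=
    (contMDiff_f₀ hn).mdifferentiableAt (by simp)
  have hd' : MDifferentiableAt I 𝓘(ℝ, ℝ) (fun g : G => f₀ I n g⁻¹) 1 :=
    ((contMDiff_f₀ hn).comp (contMDiff_inv I ∞)).mdifferentiableAt (by simp)
  have h2 := differential_mul hd hd' v
  rw [funext (f₀_mul_inv (I := I) hn), differential_const, h1] at h2
  simp only [f₀_one hn, inv_one, one_mul] at h2
  linarith

theorem differential_f₀ (hn : finrank ℝ E = n) (v : GroupLieAlgebra I G) (g : G) :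
    differential I (f₀ I n : G → ℝ) g (mulInvariantVectorField v g) =
      f₀ I n g * LinearMap.trace ℝ _ (LieAlgebra.ad ℝ (GroupLieAlgebra I G) v) := by
  have hd (x : G) : MDifferentiableAt I 𝓘(ℝ, ℝ) (f₀ I n : G → ℝ) x :=
    (contMDiff_f₀ hn).mdifferentiableAt (by simp)
  refine (differential_comp (hd g) (mdifferentiableAt_mul_left g 1) (mul_one g) v).symm.trans ?_
  rw [funext fun x => f₀_mul (I := I) hn g x]
  refine (differential_mul mdifferentiableAt_const (hd 1) v).trans ?_
  rw [differential_const, differential_f₀_one hn]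
  ring

theorem differential_sqrt_f₀ [ConnectedSpace G] (hn : finrank ℝ E = n)
    (v : GroupLieAlgebra I G) (g : G) :
    differential I (fun g : G => √(f₀ I n g)) g (mulInvariantVectorField v g) =
      √(f₀ I n g) * LinearMap.trace ℝ _ (LieAlgebra.ad ℝ (GroupLieAlgebra I G) v) / 2 := by
  have hd : MDifferentiableAt I 𝓘(ℝ, ℝ) (fun g : G => √(f₀ I n g)) g :=
    (contMDiff_sqrt_f₀ hn).mdifferentiableAt (by simp)
  have h := differential_mul hd hd (mulInvariantVectorField v g)
  have hs (x : G) : √(f₀ I n x) * √(f₀ I n x) = f₀ I n x :=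
    Real.mul_self_sqrt (f₀_pos (I := I) hn x).le
  rw [funext hs, differential_f₀ hn] at h
  have hpos : 0 < √(f₀ I n g) := Real.sqrt_pos.2 (f₀_pos hn g)
  have : √(f₀ I n g) * (√(f₀ I n g) * LinearMap.trace ℝ _
      (LieAlgebra.ad ℝ (GroupLieAlgebra I G) v)) = √(f₀ I n g) * (2 *
      differential I (fun g : G => √(f₀ I n g)) g (mulInvariantVectorField v g)) := by
    rw [← mul_assoc, hs]
    linarith
  have := mul_left_cancel₀ hpos.ne' this
  linarith

end Adjoint

/-! ### Multiplicative Poisson structures in the left trivialization -/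

section Bilinear

variable {V : Type*} [AddCommGroup V] [Module ℝ V] {ι : Type*} [Fintype ι]

theorem bilinForm_eq_sum_coord (b : Basis ι ℝ V) (B : LinearMap.BilinForm ℝ (Dual ℝ V))
    (α β : Dual ℝ V) :
    B α β = ∑ i, α (b i) * B (b.coord i) β := by
  have h : α = ∑ i, α (b i) • b.coord i := by
    ext v
    simp
  conv_lhs => rw [h]
  simp only [map_sum, map_smul, LinearMap.sum_apply, LinearMap.smul_apply, smul_eq_mul]

theorem bilinForm_dual_eq_sum (b : Basis ι ℝ V) (B : LinearMap.BilinForm ℝ (Dual ℝ V))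
    (α β : Dual ℝ V) :
    B α β = ∑ i, ∑ j, α (b i) * β (b j) * B (b.coord i) (b.coord j) := by
  rw [bilinForm_eq_sum_coord b]
  refine Finset.sum_congr rfl fun i _ => ?_
  rw [← LinearMap.flip_apply, bilinForm_eq_sum_coord b, Finset.mul_sum]
  exact Finset.sum_congr rfl fun j _ => (mul_assoc _ _ _).symm

theorem trace_dual_eq_sum (b : Basis ι ℝ V) (A : Dual ℝ V →ₗ[ℝ] Dual ℝ V) :
    LinearMap.trace ℝ (Dual ℝ V) A = ∑ j, A (b.coord j) (b j) := by
  classical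
  have := b.finiteDimensional_of_finite
  rw [LinearMap.trace_eq_matrix_trace ℝ b.dualBasis, Matrix.trace]
  refine Finset.sum_congr rfl fun j _ => ?_
  simp [LinearMap.toMatrix_apply]

theorem trace_eq_sum_coord (b : Basis ι ℝ V) (A : V →ₗ[ℝ] V) :
    LinearMap.trace ℝ V A = ∑ j, b.coord j (A (b j)) := by
  classical
  rw [LinearMap.trace_eq_matrix_trace ℝ b, Matrix.trace]
  refine Finset.sum_congr rfl fun j _ => ?_
  simp [LinearMap.toMatrix_apply]

variable {E : Type*} [NormedAddCommGroup E] [NormedSpace ℝ E]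
  {H : Type*} [TopologicalSpace H] {I : ModelWithCorners ℝ E H}
  {M : Type*} [TopologicalSpace M] [ChartedSpace H M]

/-- The product rule for a bilinear form evaluated on covector-valued functions. -/
theorem differential_bilinForm [FiniteDimensional ℝ V] (B : LinearMap.BilinForm ℝ (Dual ℝ V))
    {A C : M → Dual ℝ V} {A' C' : Dual ℝ V} {x : M} {v : TangentSpace I x}
    (hA : ∀ u, MDifferentiableAt I 𝓘(ℝ, ℝ) (fun y => A y u) x)
    (hC : ∀ u, MDifferentiableAt I 𝓘(ℝ, ℝ) (fun y => C y u) x)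
    (hA' : ∀ u, differential I (fun y => A y u) x v = A' u)
    (hC' : ∀ u, differential I (fun y => C y u) x v = C' u) :
    MDifferentiableAt I 𝓘(ℝ, ℝ) (fun y => B (A y) (C y)) x ∧
      differential I (fun y => B (A y) (C y)) x v = B A' (C x) + B (A x) C' := by
  let b := finBasis ℝ V
  rw [funext fun y => bilinForm_dual_eq_sum b B (A y) (C y), bilinForm_dual_eq_sum b B A' (C x),
    bilinForm_dual_eq_sum b B (A x) C']
  have hm (i j) : MDifferentiableAt I 𝓘(ℝ, ℝ)
      (fun y => A y (b i) * C y (b j) * B (b.coord i) (b.coord j)) x :=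
    mdifferentiableAt_fun_mul (mdifferentiableAt_fun_mul (hA _) (hC _)) mdifferentiableAt_const
  refine ⟨mdifferentiableAt_fun_sum fun i _ => mdifferentiableAt_fun_sum fun j _ => hm i j, ?_⟩
  rw [differential_sum fun i _ => mdifferentiableAt_fun_sum fun j _ => hm i j,
    ← Finset.sum_add_distrib]
  refine Finset.sum_congr rfl fun i _ => ?_
  rw [differential_sum fun j _ => hm i j, ← Finset.sum_add_distrib]
  refine Finset.sum_congr rfl fun j _ => ?_
  rw [differential_mul (mdifferentiableAt_fun_mul (hA _) (hC _)) mdifferentiableAt_const,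
    differential_mul (hA _) (hC _), differential_const, hA', hC']
  ring

end Bilinear

section PoissonLieGroup

variable {E : Type*} [NormedAddCommGroup E] [NormedSpace ℝ E]
  {H : Type*} [TopologicalSpace H] {I : ModelWithCorners ℝ E H}
  {G : Type*} [TopologicalSpace G] [ChartedSpace H G] [Group G] [LieGroup I ∞ G]

variable (I G) in
/-- The modular character `v ↦ Tr(ad v)` of the Lie algebra. -/
def traceAd [CompleteSpace E] : Dual ℝ (GroupLieAlgebra I G) where
  toFun v := LinearMap.trace ℝ _ (LieAlgebra.ad ℝ (GroupLieAlgebra I G) v)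
  map_add' v w := by rw [map_add, map_add]
  map_smul' c v := by rw [map_smul, map_smul]; rfl

theorem traceAd_apply [CompleteSpace E] (v : GroupLieAlgebra I G) :
    traceAd I G v = LinearMap.trace ℝ _ (LieAlgebra.ad ℝ (GroupLieAlgebra I G) v) := rfl

/-- The value at `g` of a Poisson structure, left-translated to the identity. -/
def PoissonStructure.leftBilin (P : PoissonStructure I G) (g : G) :
    LinearMap.BilinForm ℝ (Dual ℝ (GroupLieAlgebra I G)) :=
  (P.toBilin g).compl₁₂ (leftTrivialization I g).toLinearMap.dualMap
    (leftTrivialization I g).toLinearMap.dualMap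

theorem PoissonStructure.leftBilin_apply (P : PoissonStructure I G) (g : G)
    (α β : Dual ℝ (GroupLieAlgebra I G)) :
    P.leftBilin g α β =
      P.toBilin g (leftInvariantOneForm I α g) (leftInvariantOneForm I β g) := rfl

theorem PoissonStructure.leftBilin_swap (P : PoissonStructure I G) (g : G)
    (α β : Dual ℝ (GroupLieAlgebra I G)) : P.leftBilin g α β = -P.leftBilin g β α := by
  have := (P.alt g).neg_eq (leftInvariantOneForm I α g) (leftInvariantOneForm I β g)
  rw [leftBilin_apply, leftBilin_apply, ← this, neg_neg]

/-- The left-translated Poisson structure is a cocycle for the adjoint representation. -/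
theorem PoissonStructure.IsMultiplicative.leftBilin_mul {P : PoissonStructure I G}
    (hP : P.IsMultiplicative) (g h : G) (α β : Dual ℝ (GroupLieAlgebra I G)) :
    P.leftBilin (g * h) α β = P.leftBilin h α β +
      P.leftBilin g (α ∘ₗ (Ad I h⁻¹).toLinearMap) (β ∘ₗ (Ad I h⁻¹).toLinearMap) := by
  have h1 (γ : Dual ℝ (GroupLieAlgebra I G)) :
      leftInvariantOneForm I γ (g * h) ∘ₗ (mfderiv I I (fun x : G => g * x) h).toLinearMap =
        leftInvariantOneForm I γ h :=
    LinearMap.ext fun v => congrArg γ (leftTrivialization_mfderiv_mul_left g h v)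
  have h2 (γ : Dual ℝ (GroupLieAlgebra I G)) :
      leftInvariantOneForm I γ (g * h) ∘ₗ (mfderiv I I (fun x : G => x * h) g).toLinearMap =
        leftInvariantOneForm I (γ ∘ₗ (Ad I h⁻¹).toLinearMap) g :=
    LinearMap.ext fun v => congrArg γ (leftTrivialization_mfderiv_mul_right g h v)
  simp only [leftBilin_apply]
  rw [hP g h, h1, h1, h2, h2]

variable [FiniteDimensional ℝ E]

theorem PoissonStructure.mdifferentiableAt_leftBilin (P : PoissonStructure I G) (g : G)
    (α β : Dual ℝ (GroupLieAlgebra I G)) :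
    MDifferentiableAt I 𝓘(ℝ, ℝ) (fun x : G => P.leftBilin x α β) g :=
  (P.contMDiff_left α β).mdifferentiableAt (by simp)

theorem PoissonStructure.cobracket_apply (P : PoissonStructure I G) (ξ : GroupLieAlgebra I G)
    (α β : Dual ℝ (GroupLieAlgebra I G)) :
    P.cobracket ξ α β = differential I (fun x : G => P.leftBilin x α β) 1 ξ := rfl

/-- The left derivative of a multiplicative Poisson structure, by conjugation. -/
theorem PoissonStructure.IsMultiplicative.differential_leftBilin_eq_cobracket
    {P : PoissonStructure I G} (hP : P.IsMultiplicative) (g : G) (η : GroupLieAlgebra I G)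
    (α β : Dual ℝ (GroupLieAlgebra I G)) :
    differential I (fun x : G => P.leftBilin x α β) g (mulInvariantVectorField η g) =
      P.cobracket (Ad I g η) (α ∘ₗ (Ad I g⁻¹).toLinearMap) (β ∘ₗ (Ad I g⁻¹).toLinearMap) := by
  have hAd (γ : Dual ℝ (GroupLieAlgebra I G)) :
      (γ ∘ₗ (Ad I g⁻¹).toLinearMap) ∘ₗ (Ad I g⁻¹⁻¹).toLinearMap = γ :=
    LinearMap.ext fun v => congrArg γ (Ad_Ad_inv g⁻¹ v)
  have h1 : (fun x : G => P.leftBilin (g * x * g⁻¹) (α ∘ₗ (Ad I g⁻¹).toLinearMap)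
      (β ∘ₗ (Ad I g⁻¹).toLinearMap)) = fun x : G => P.leftBilin g⁻¹
        (α ∘ₗ (Ad I g⁻¹).toLinearMap) (β ∘ₗ (Ad I g⁻¹).toLinearMap) +
        P.leftBilin (g * x) α β := by
    funext x
    rw [hP.leftBilin_mul (g * x) g⁻¹, hAd, hAd]
  have h2 := differential_comp (I := I) (P.mdifferentiableAt_leftBilin (1 : G)
    (α ∘ₗ (Ad I g⁻¹).toLinearMap) (β ∘ₗ (Ad I g⁻¹).toLinearMap))
    (mdifferentiableAt_conj g g⁻¹ 1) (by simp) η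
  have h3 := differential_comp (I := I) (P.mdifferentiableAt_leftBilin g α β)
    (mdifferentiableAt_mul_left g 1) (mul_one g) η
  have h4 : MDifferentiableAt I 𝓘(ℝ, ℝ) (fun x : G => P.leftBilin (g * x) α β) 1 :=
    MDifferentiableAt.comp (g := fun x : G => P.leftBilin x α β) (1 : G)
      (P.mdifferentiableAt_leftBilin (g * 1) α β) (mdifferentiableAt_mul_left g 1)
  rw [h1, differential_add I mdifferentiableAt_const h4, LinearMap.add_apply] at h2
  have h5 := differential_const (I := I) (P.leftBilin g⁻¹ (α ∘ₗ (Ad I g⁻¹).toLinearMap)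
    (β ∘ₗ (Ad I g⁻¹).toLinearMap)) (1 : G) η
  rw [h5, zero_add] at h2
  exact h3.symm.trans h2

/-- The left-invariant divergence of a multiplicative Poisson structure vanishes when the dual Lie
algebra is unimodular. -/
theorem PoissonStructure.IsMultiplicative.sum_differential_leftBilin_coord
    {P : PoissonStructure I G} (hP : P.IsMultiplicative) (hu : P.IsUnimodularDual)
    {ι : Type*} [Fintype ι] (b : Basis ι ℝ (GroupLieAlgebra I G)) (g : G)
    (α : Dual ℝ (GroupLieAlgebra I G)) :
    ∑ j, differential I (fun x : G => P.leftBilin x α (b.coord j)) g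
      (mulInvariantVectorField (b j) g) = 0 := by
  let e : GroupLieAlgebra I G ≃ₗ[ℝ] GroupLieAlgebra I G :=
    LinearEquiv.ofLinearMap (Ad I g).toLinearMap (Ad I g⁻¹).toLinearMap
      (LinearMap.ext fun v => Ad_Ad_inv g v) (LinearMap.ext fun v => Ad_inv_Ad g v)
  have h := hu (α ∘ₗ (Ad I g⁻¹).toLinearMap)
  rw [trace_dual_eq_sum (b.map e)] at h
  rw [← h]
  refine Finset.sum_congr rfl fun j _ => ?_
  rw [hP.differential_leftBilin_eq_cobracket, adDual_apply, Basis.map_apply]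
  rfl

variable [I.Boundaryless] [CompleteSpace E]

/-- The left derivative of a multiplicative Poisson structure, by the cocycle identity. -/
theorem PoissonStructure.IsMultiplicative.differential_leftBilin
    {P : PoissonStructure I G} (hP : P.IsMultiplicative) (g : G) (ξ : GroupLieAlgebra I G)
    (α β : Dual ℝ (GroupLieAlgebra I G)) :
    differential I (fun x : G => P.leftBilin x α β) g (mulInvariantVectorField ξ g) =
      P.cobracket ξ α β - P.leftBilin g (α ∘ₗ LieAlgebra.ad ℝ _ ξ) β -
        P.leftBilin g α (β ∘ₗ LieAlgebra.ad ℝ _ ξ) := by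
  have h3 := differential_comp (I := I) (P.mdifferentiableAt_leftBilin g α β)
    (mdifferentiableAt_mul_left g 1) (mul_one g) ξ
  refine h3.symm.trans ?_
  rw [funext fun x => hP.leftBilin_mul g x α β]
  have hd (γ : Dual ℝ (GroupLieAlgebra I G)) (u : GroupLieAlgebra I G) :
      MDifferentiableAt I 𝓘(ℝ, ℝ) (fun x : G => (γ ∘ₗ (Ad I x⁻¹).toLinearMap) u) 1 :=
    (contMDiff_Ad_inv u γ).mdifferentiableAt (by simp)
  have hd' (γ : Dual ℝ (GroupLieAlgebra I G)) (u : GroupLieAlgebra I G) :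
      differential I (fun x : G => (γ ∘ₗ (Ad I x⁻¹).toLinearMap) u) 1 ξ =
        (-(γ ∘ₗ LieAlgebra.ad ℝ _ ξ) : Dual ℝ (GroupLieAlgebra I G)) u :=
    differential_Ad_inv ξ u γ
  have hB := differential_bilinForm (P.leftBilin g) (hd α) (hd β) (hd' α) (hd' β)
  have hone (γ : Dual ℝ (GroupLieAlgebra I G)) :
      γ ∘ₗ (Ad I (1 : G)⁻¹).toLinearMap = γ :=
    LinearMap.ext fun v => by simp
  have h4 := LinearMap.congr_fun
    (differential_add I (P.mdifferentiableAt_leftBilin (1 : G) α β) hB.1) ξ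
  refine h4.trans ?_
  rw [LinearMap.add_apply, hB.2, hone, hone, ← P.cobracket_apply]
  simp only [map_neg, LinearMap.neg_apply]
  ring

theorem PoissonStructure.IsMultiplicative.sum_leftBilin_ad_coord
    {P : PoissonStructure I G} (hP : P.IsMultiplicative) (hu : P.IsUnimodularDual)
    {ι : Type*} [Fintype ι] (b : Basis ι ℝ (GroupLieAlgebra I G)) (g : G)
    (α : Dual ℝ (GroupLieAlgebra I G)) :
    ∑ j, P.leftBilin g (α ∘ₗ LieAlgebra.ad ℝ _ (b j)) (b.coord j) =
      P.leftBilin g α (traceAd I G) := by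
  have h1 := hP.sum_differential_leftBilin_coord hu b g α
  simp only [hP.differential_leftBilin, Finset.sum_sub_distrib] at h1
  have h2 := hu α
  rw [trace_dual_eq_sum b] at h2
  simp only [adDual_apply] at h2
  have h3 : ∑ j, P.leftBilin g α (b.coord j ∘ₗ LieAlgebra.ad ℝ _ (b j)) =
      -P.leftBilin g α (traceAd I G) := by
    rw [← map_sum, ← map_neg]
    congr 1
    ext v
    have := trace_eq_sum_coord b (LieAlgebra.ad ℝ (GroupLieAlgebra I G) v)
    simp only [LinearMap.sum_apply, LinearMap.comp_apply, LinearMap.neg_apply,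
      LieAlgebra.ad_apply, traceAd_apply] at this ⊢
    rw [this, ← Finset.sum_neg_distrib]
    refine Finset.sum_congr rfl fun j _ => ?_
    rw [← lie_skew, map_neg]
  rw [h2, h3] at h1
  linarith

end PoissonLieGroup

/-! ### Lie derivatives of multiples of left-invariant volume forms -/

section Divergence

variable {E : Type*} [NormedAddCommGroup E] [NormedSpace ℝ E]
  {H : Type*} [TopologicalSpace H] {I : ModelWithCorners ℝ E H}
  {G : Type*} [TopologicalSpace G] [ChartedSpace H G] [Group G]

variable (I) in
/-- The differential of a function at `g`, left-translated to the identity. -/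
def leftDifferential (F : G → ℝ) (g : G) : Dual ℝ (GroupLieAlgebra I G) where
  toFun v := differential I F g (mulInvariantVectorField v g)
  map_add' v w := by rw [mulInvariantVectorField_add, Pi.add_apply, map_add]
  map_smul' c v := by rw [mulInvariantVectorField_smul, Pi.smul_apply, map_smul]; rfl

theorem leftDifferential_apply (F : G → ℝ) (g : G) (v : GroupLieAlgebra I G) :
    leftDifferential I F g v = differential I F g (mulInvariantVectorField v g) := rfl

variable [LieGroup I ∞ G]

theorem leftDifferential_leftTrivialization (F : G → ℝ) (g : G) (X : TangentSpace I g) :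
    leftDifferential I F g (leftTrivialization I g X) = differential I F g X := by
  rw [leftDifferential_apply, mulInvariantVectorField_leftTrivialization]

variable [CompleteSpace E]

theorem mdifferentiableAt_leftDifferential_apply [I.Boundaryless] {K : G → ℝ}
    (hK : ContMDiff I 𝓘(ℝ, ℝ) ∞ K) (g : G) (v : GroupLieAlgebra I G) :
    MDifferentiableAt I 𝓘(ℝ, ℝ) (fun y => leftDifferential I K y v) g :=
  mdifferentiableAt_differential_apply
    ((hK.of_le (WithTop.coe_le_coe.2 (le_top : (2 : ℕ∞) ≤ ⊤))) g)
    (mdifferentiableAt_section_mulInvariantVectorField v g)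

theorem leftDifferential_lie [I.Boundaryless] {K : G → ℝ}
    (hK : ContMDiff I 𝓘(ℝ, ℝ) ∞ K) (g : G) (v w : GroupLieAlgebra I G) :
    leftDifferential I K g ⁅v, w⁆ =
      differential I (fun y => leftDifferential I K y w) g (mulInvariantVectorField v g) -
        differential I (fun y => leftDifferential I K y v) g (mulInvariantVectorField w g) := by
  have h := differential_mlieBracket
    ((hK.of_le (WithTop.coe_le_coe.2 (le_top : (2 : ℕ∞) ≤ ⊤))) g)
    (mdifferentiableAt_section_mulInvariantVectorField v g)
    (mdifferentiableAt_section_mulInvariantVectorField w g)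
  rw [← mulInvariantVector_mlieBracket] at h
  exact h

variable [FiniteDimensional ℝ E] {n : ℕ}

/-- The Lie derivative of `f νˡ`, in terms of the divergence of a vector field in the left
trivialization. -/
theorem lieDerivative_smul_leftInvariantForm (hn : finrank ℝ E = n)
    (ν : (GroupLieAlgebra I G) [⋀^Fin n]→ₗ[ℝ] ℝ) {f : G → ℝ} {g : G}
    (hf : MDifferentiableAt I 𝓘(ℝ, ℝ) f g) {X : ∀ g : G, TangentSpace I g}
    (hX : ∀ α : Dual ℝ (GroupLieAlgebra I G),
      MDifferentiableAt I 𝓘(ℝ, ℝ) (fun y => α (leftTrivialization I y (X y))) g)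
    {Y : Fin n → ∀ g : G, TangentSpace I g} (hY : ∀ i, IsSmoothVectorField I (Y i))
    {ι : Type*} [Fintype ι] (b : Basis ι ℝ (GroupLieAlgebra I G)) :
    lieDerivative I X (fun g => f g • leftInvariantForm I ν g) Y g =
      (differential I f g (X g) + f g *
        (∑ j, differential I (fun y => b.coord j (leftTrivialization I y (X y))) g
          (mulInvariantVectorField (b j) g) - traceAd I G (leftTrivialization I g (X g)))) *
        ν (fun i => leftTrivialization I g (Y i g)) := by
  classical
  let D : GroupLieAlgebra I G →ₗ[ℝ] GroupLieAlgebra I G :=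
    ∑ j, (leftDifferential I (fun y => b.coord j (leftTrivialization I y (X y))) g).smulRight (b j)
  let A : GroupLieAlgebra I G →ₗ[ℝ] GroupLieAlgebra I G :=
    D - LieAlgebra.ad ℝ (GroupLieAlgebra I G) (leftTrivialization I g (X g))
  have hYd (i) (α : Dual ℝ (GroupLieAlgebra I G)) :
      MDifferentiableAt I 𝓘(ℝ, ℝ) (fun y => α (leftTrivialization I y (Y i y))) g :=
    (contMDiff_dual_leftTrivialization (hY i) α).mdifferentiableAt (by simp)
  have hD (α : Dual ℝ (GroupLieAlgebra I G)) (v : TangentSpace I g) :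
      α (D (leftTrivialization I g v)) =
        differential I (fun y => α (leftTrivialization I y (X y))) g v := by
    rw [differential_dual_eq_sum_coord b hX]
    simp only [D, LinearMap.sum_apply, LinearMap.smulRight_apply,
      leftDifferential_leftTrivialization, map_sum, map_smul, smul_eq_mul]
  have hz (i) (α : Dual ℝ (GroupLieAlgebra I G)) :
      differential I (fun y => α (leftTrivialization I y (Y i y))) g (X g) =
        α (leftTrivialization I g (mlieBracket I X (Y i) g) +
          A (leftTrivialization I g (Y i g))) := by
    rw [map_add, dual_leftTrivialization_mlieBracket hX (hYd i) α]
    simp only [A, LinearMap.sub_apply, map_sub, hD, LieAlgebra.ad_apply]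
    ring
  have htr : LinearMap.trace ℝ _ A =
      ∑ j, differential I (fun y => b.coord j (leftTrivialization I y (X y))) g
        (mulInvariantVectorField (b j) g) - traceAd I G (leftTrivialization I g (X g)) := by
    rw [map_sub, ← traceAd_apply, trace_eq_sum_coord b D]
    congr 1
    refine Finset.sum_congr rfl fun j _ => ?_
    rw [← hD, leftTrivialization_mulInvariantVectorField]
  have hνd : MDifferentiableAt I 𝓘(ℝ, ℝ)
      (fun y => ν (fun i => leftTrivialization I y (Y i y))) g :=
    (contMDiff_alternatingMap ν fun i α =>
      contMDiff_dual_leftTrivialization (hY i) α).mdifferentiableAt (by simp)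
  have h1 : differential I (fun y => ν (fun i => leftTrivialization I y (Y i y))) g (X g) =
      ∑ i, ν (Function.update (fun j => leftTrivialization I g (Y j g)) i
        (leftTrivialization I g (mlieBracket I X (Y i) g))) +
      LinearMap.trace ℝ _ A * ν (fun i => leftTrivialization I g (Y i g)) := by
    rw [differential_alternatingMap ν hYd hz, ← sum_alternatingMap_update
      (finrank_groupLieAlgebra hn), ← Finset.sum_add_distrib]
    exact Finset.sum_congr rfl fun i _ => ν.map_update_add _ _ _ _
  have h2 (i) : (f g • leftInvariantForm I ν g)
      (Function.update (fun j => Y j g) i (mlieBracket I X (Y i) g)) =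
      f g * ν (Function.update (fun j => leftTrivialization I g (Y j g)) i
        (leftTrivialization I g (mlieBracket I X (Y i) g))) := by
    refine congrArg (fun z => f g * ν z) (funext fun j => ?_)
    exact Function.apply_update (fun _ => leftTrivialization I g) _ i _ j
  unfold lieDerivative
  rw [Finset.sum_congr rfl fun i _ => h2 i, ← Finset.mul_sum]
  have h3 := differential_mul hf hνd (X g)
  rw [h1, htr] at h3
  refine (congrArg (· - _) h3).trans ?_
  ring

end Divergence

/-! ### Hamiltonian vector fields -/

section Hamiltonian

variable {E : Type*} [NormedAddCommGroup E] [NormedSpace ℝ E] [FiniteDimensional ℝ E]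
  {H : Type*} [TopologicalSpace H] {I : ModelWithCorners ℝ E H}
  {G : Type*} [TopologicalSpace G] [ChartedSpace H G] [Group G] [LieGroup I ∞ G]

theorem PoissonStructure.dual_leftTrivialization_hamiltonianVectorField
    (P : PoissonStructure I G) (K : G → ℝ) (g : G) (α : Dual ℝ (GroupLieAlgebra I G)) :
    α (leftTrivialization I g (P.hamiltonianVectorField K g)) =
      P.leftBilin g (leftDifferential I K g) α := by
  have h : leftInvariantOneForm I (leftDifferential I K g) g = differential I K g :=
    LinearMap.ext fun X => leftDifferential_leftTrivialization K g X
  rw [leftBilin_apply, h]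
  exact P.apply_sharp g (differential I K g) (leftInvariantOneForm I α g)

theorem isVolumeForm_sqrt_f₀_smul_leftInvariantForm [ConnectedSpace G] {n : ℕ}
    (hn : finrank ℝ E = n) {ν : (GroupLieAlgebra I G) [⋀^Fin n]→ₗ[ℝ] ℝ} (hν : ν ≠ 0) :
    IsVolumeForm I (fun g : G => √(f₀ I n g) • leftInvariantForm I ν g) where
  top_degree := hn
  smooth Y hY := (contMDiff_sqrt_f₀ hn).mul
    (contMDiff_alternatingMap ν fun i α => contMDiff_dual_leftTrivialization (hY i) α)
  ne_zero g h := by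
    refine hν (AlternatingMap.ext fun v => ?_)
    have h1 : √(f₀ I n g) * ν (fun i => leftTrivialization I g
        (mulInvariantVectorField (v i) g)) = 0 :=
      congrArg (fun Φ => Φ (fun i => mulInvariantVectorField (v i) g)) h
    simp only [leftTrivialization_mulInvariantVectorField] at h1
    exact (mul_eq_zero.1 h1).resolve_left (Real.sqrt_pos.2 (f₀_pos hn g)).ne'

variable [I.Boundaryless] [CompleteSpace E]

theorem PoissonStructure.mdifferentiableAt_hamiltonianVectorField (P : PoissonStructure I G)
    {K : G → ℝ} (hK : ContMDiff I 𝓘(ℝ, ℝ) ∞ K) (g : G) (α : Dual ℝ (GroupLieAlgebra I G)) :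
    MDifferentiableAt I 𝓘(ℝ, ℝ)
      (fun y => α (leftTrivialization I y (P.hamiltonianVectorField K y))) g := by
  simp only [dual_leftTrivialization_hamiltonianVectorField]
  rw [funext fun y => bilinForm_eq_sum_coord (finBasis ℝ (GroupLieAlgebra I G))
    (P.leftBilin y) (leftDifferential I K y) α]
  exact mdifferentiableAt_fun_sum fun i _ => mdifferentiableAt_fun_mul
    (mdifferentiableAt_leftDifferential_apply hK g _) (P.mdifferentiableAt_leftBilin g _ _)

/-- The divergence of a Hamiltonian vector field in the left trivialization. -/
theorem PoissonStructure.IsMultiplicative.sum_differential_hamiltonianVectorField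
    {P : PoissonStructure I G} (hP : P.IsMultiplicative) (hu : P.IsUnimodularDual)
    {K : G → ℝ} (hK : ContMDiff I 𝓘(ℝ, ℝ) ∞ K) (g : G) {ι : Type*} [Fintype ι]
    (b : Basis ι ℝ (GroupLieAlgebra I G)) :
    ∑ j, differential I (fun y => b.coord j (leftTrivialization I y
      (P.hamiltonianVectorField K y))) g (mulInvariantVectorField (b j) g) =
      traceAd I G (leftTrivialization I g (P.hamiltonianVectorField K g)) / 2 := by
  let κ := fun y => leftDifferential I K y
  let S := ∑ j, ∑ i, P.leftBilin g (b.coord i) (b.coord j) *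
    differential I (fun y => κ y (b i)) g (mulInvariantVectorField (b j) g)
  have h1 : ∑ j, differential I (fun y => b.coord j (leftTrivialization I y
      (P.hamiltonianVectorField K y))) g (mulInvariantVectorField (b j) g) = S := by
    have hj (j) : differential I (fun y => b.coord j (leftTrivialization I y
        (P.hamiltonianVectorField K y))) g (mulInvariantVectorField (b j) g) =
        ∑ i, (κ g (b i) * differential I (fun y => P.leftBilin y (b.coord i) (b.coord j)) g
          (mulInvariantVectorField (b j) g) + P.leftBilin g (b.coord i) (b.coord j) *
          differential I (fun y => κ y (b i)) g (mulInvariantVectorField (b j) g)) := by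
      simp only [dual_leftTrivialization_hamiltonianVectorField]
      rw [funext fun y => bilinForm_eq_sum_coord b (P.leftBilin y) (leftDifferential I K y) _,
        differential_sum fun i _ => mdifferentiableAt_fun_mul
          (mdifferentiableAt_leftDifferential_apply hK g _) (P.mdifferentiableAt_leftBilin g _ _)]
      exact Finset.sum_congr rfl fun i _ => differential_mul
        (mdifferentiableAt_leftDifferential_apply hK g _) (P.mdifferentiableAt_leftBilin g _ _) _
    simp only [hj, Finset.sum_add_distrib]
    rw [Finset.sum_comm]
    simp only [← Finset.mul_sum, hP.sum_differential_leftBilin_coord hu b g, mul_zero,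
      Finset.sum_const_zero, zero_add]
    rfl
  have h2 : S + S = ∑ j, ∑ i, κ g ⁅b j, b i⁆ * P.leftBilin g (b.coord i) (b.coord j) := by
    have hS : S = ∑ j, ∑ i, P.leftBilin g (b.coord j) (b.coord i) *
        differential I (fun y => κ y (b j)) g (mulInvariantVectorField (b i) g) :=
      Finset.sum_comm
    conv_lhs => rw [hS]
    conv_lhs => lhs; rw [← hS]
    rw [← Finset.sum_add_distrib]
    refine Finset.sum_congr rfl fun j _ => ?_
    rw [← Finset.sum_add_distrib]
    refine Finset.sum_congr rfl fun i _ => ?_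
    rw [P.leftBilin_swap g (b.coord j), leftDifferential_lie hK]
    ring
  have h3 : ∑ j, ∑ i, κ g ⁅b j, b i⁆ * P.leftBilin g (b.coord i) (b.coord j) =
      traceAd I G (leftTrivialization I g (P.hamiltonianVectorField K g)) := by
    rw [P.dual_leftTrivialization_hamiltonianVectorField, ← hP.sum_leftBilin_ad_coord hu b]
    refine Finset.sum_congr rfl fun j _ => ?_
    rw [bilinForm_eq_sum_coord b]
    rfl
  rw [h1]
  linarith

theorem PoissonStructure.IsMultiplicative.preserves_sqrt_f₀_smul_leftInvariantForm
    [ConnectedSpace G] {n : ℕ}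
    {P : PoissonStructure I G} (hP : P.IsMultiplicative) (hu : P.IsUnimodularDual)
    (hn : finrank ℝ E = n) (ν : (GroupLieAlgebra I G) [⋀^Fin n]→ₗ[ℝ] ℝ)
    {K : G → ℝ} (hK : ContMDiff I 𝓘(ℝ, ℝ) ∞ K) :
    Preserves I (P.hamiltonianVectorField K)
      (fun g : G => √(f₀ I n g) • leftInvariantForm I ν g) := by
  intro Y hY g
  rw [lieDerivative_smul_leftInvariantForm hn ν
    ((contMDiff_sqrt_f₀ hn).mdifferentiableAt (by simp))
    (P.mdifferentiableAt_hamiltonianVectorField hK g) hY (finBasis ℝ (GroupLieAlgebra I G)),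
    hP.sum_differential_hamiltonianVectorField hu hK]
  have h := differential_sqrt_f₀ hn (leftTrivialization I g (P.hamiltonianVectorField K g)) g
  rw [mulInvariantVectorField_leftTrivialization, ← traceAd_apply] at h
  rw [h]
  ring

end Hamiltonian

end PoissonLie

end

theorem corollary3p3
    {E : Type*} [NormedAddCommGroup E] [NormedSpace ℝ E] [FiniteDimensional ℝ E]
    {H : Type*} [TopologicalSpace H] (I : ModelWithCorners ℝ E H) [I.Boundaryless]
    {G : Type*} [TopologicalSpace G] [ChartedSpace H G] [Group G] [LieGroup I ∞ G]
    [ConnectedSpace G] (n : ℕ) (hn : Module.finrank ℝ E = n)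
    (P : PoissonLie.PoissonStructure I G) (hP : P.IsMultiplicative) (hu : P.IsUnimodularDual)
    (ν : (GroupLieAlgebra I G) [⋀^Fin n]→ₗ[ℝ] ℝ) (hν : ν ≠ 0) :
    PoissonLie.IsVolumeForm I
        (fun g : G => √(PoissonLie.f₀ I n g) • PoissonLie.leftInvariantForm I ν g) ∧
      ∀ K : G → ℝ, ContMDiff I 𝓘(ℝ, ℝ) ∞ K →
        PoissonLie.Preserves I (P.hamiltonianVectorField K)
          (fun g : G => √(PoissonLie.f₀ I n g) • PoissonLie.leftInvariantForm I ν g) := by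
  have : CompleteSpace E := FiniteDimensional.complete ℝ E
  exact ⟨PoissonLie.isVolumeForm_sqrt_f₀_smul_leftInvariantForm hn hν,
    fun _ hK => hP.preserves_sqrt_f₀_smul_leftInvariantForm hu hn ν hK⟩
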